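/- Let $\Sigma\subset\mathbb R^2$ be (the trace of) a support curve: a smooth, convex, simple, smoothly closed plane curve ${}^\Sigma f$, parametrized by arclength and positively oriented, so that its curvature satisfies ${}^\Sigma\kappa\ge 0$. Denote by ${}^\Sigma\vec\tau(x)$ the unit tangent of $\Sigma$ at $x\in\Sigma$, by ${}^\Sigma\kappa_{\max}$ the maximum of the curvature of $\Sigma$, and put ${}^\Sigma d=\min\{|x-y| : x,y\in\Sigma,\ {}^\Sigma\vec\tau(x)=-{}^\Sigma\vec\tau(y)\}$. For a regular curve let $\tau$ be its unit tangent, $\nu=J\tau$ its normal ($J$ the rotation by $+\pi/2$), $\kappa$ its curvature with respect to $\nu$, $L$ its length, $s$ its arclength, and $\bar\kappa=\frac1L\int\kappa\,ds$ the average of its curvature. Let $a<b$, $0<T\le\infty$, and let $c:[a,b]\times[0,T)\to\mathbb R^2$ be a solution of the area preserving curve shortening problem with Neumann free boundary conditions outside $\Sigma$ with initial curve $c_0$. That is: $c_0:[a,b]\to\mathbb R^2$ is smooth and regular; the curves $c_t=c(\cdot,t)$ are regular; $c$ is smooth on $[a,b]\times(0,T)$, and $c,\partial_pc,\partial_p^2c,\partial_tc$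 are continuous on $[a,b]\times[0,T)$; and $$\partial_t c=(\kappa-\bar\kappa)\,\nu\ \text{ on }[a,b]\times[0,T),\qquad c(\cdot,0)=c_0,$$ and, for all $t\in[0,T)$, $c(a,t),c(b,t)\in\Sigma$, the oriented angle from $\tau(a,t)$ to ${}^\Sigma\vec\tau(c(a,t))$ is $\frac{\pi}{2}$, and the oriented angle from $\tau(b,t)$ to ${}^\Sigma\vec\tau(c(b,t))$ is $-\frac{\pi}{2}$. Suppose that (A) $\kappa_0>0$ on $[a,b]$, where $\kappa_0$ is the curvature of $c_0$; (B) $c_0$ has no self-intersection, i.e. it is injective on $[a,b]$; (C) $c_0$ is contained in the outer domain created by $\Sigma$: $c_0(p)$ lies in the unbounded component of $\mathbb R^2\setminus\Sigma$ for every $p\in(a,b)$; (D) $L_0:=L(c_0)<{}^\Sigma d$. The constant $C(\Sigma)=\frac{1}{2\,{}^\Sigma\kappa_{\max}}$ is well defined and positive, and if $L_0<C(\Sigma)$, then for every $t\in[0,T)$: 1. the curve $c_t$ is embedded; 2. the curve $c_t$ together with the line segment from $c(b,t)$ to $c(a,t)$ traces out a convex domain: the segment is non-degenerate and meets $c_t$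 only in the two end points, and the union of $c_t$ and the segment is the boundary of a nonempty bounded open convex set. -/

import Mathlib

open Set
open scoped ContDiff

noncomputable section

attribute [local instance] Complex.finrank_real_complex_fact

/- The Euclidean plane is `ℂ` with its real inner product; the rotation `J` by `+π/2` is
multiplication by `Complex.I`, and oriented angles are those of the standard orientation. -/

namespace PlaneCurve

/-- The derivative `∂ₚγ` of a curve `γ : [a,b] → ℝ²` (one-sided at the end points). -/
def velocity (a b : ℝ) (γ : ℝ → ℂ) (p : ℝ) : ℂ := derivWithin γ (Icc a b) p

/-- The second derivative `∂ₚ²γ` of a curve `γ : [a,b] → ℝ²`. -/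
def acceleration (a b : ℝ) (γ : ℝ → ℂ) (p : ℝ) : ℂ := derivWithin (velocity a b γ) (Icc a b) p

/-- The unit tangent `τ = ∂ₚγ / |∂ₚγ|`. -/
def tangent (a b : ℝ) (γ : ℝ → ℂ) (p : ℝ) : ℂ := (‖velocity a b γ p‖⁻¹ : ℝ) • velocity a b γ p

/-- The normal `ν = J τ`. -/
def normal (a b : ℝ) (γ : ℝ → ℂ) (p : ℝ) : ℂ := Complex.I * tangent a b γ p

/-- The curvature `κ = ⟨∂ₚ²γ, ν⟩ / |∂ₚγ|²`. -/
def curvature (a b : ℝ) (γ : ℝ → ℂ) (p : ℝ) : ℝ :=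
  inner ℝ (acceleration a b γ p) (normal a b γ p) / ‖velocity a b γ p‖ ^ 2

/-- The length `L(γ) = ∫ ds`, with `ds = |∂ₚγ| dp`. -/
def length (a b : ℝ) (γ : ℝ → ℂ) : ℝ := ∫ p in a..b, ‖velocity a b γ p‖

/-- The average of the curvature, `κ̄ = (∫ κ ds) / (∫ ds)`. -/
def meanCurvature (a b : ℝ) (γ : ℝ → ℂ) : ℝ :=
  (∫ p in a..b, curvature a b γ p * ‖velocity a b γ p‖) / length a b γ

/-- The curve `γ : [a,b] → ℝ²` is regular. -/
def Regular (a b : ℝ) (γ : ℝ → ℂ) : Prop := ∀ p ∈ Icc a b, velocity a b γ p ≠ 0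

/-- The curve `γ : [a,b] → ℝ²` is embedded: regular and without self-intersection. -/
def Embedded (a b : ℝ) (γ : ℝ → ℂ) : Prop := Regular a b γ ∧ InjOn γ (Icc a b)

/-- The curve `γ : [a,b] → ℝ²` and the line segment joining its end points trace out a convex
domain: they meet only in the (distinct) end points, and together they form the boundary of a
nonempty bounded open convex set. -/
def BoundsConvexDomain (a b : ℝ) (γ : ℝ → ℂ) : Prop :=
  γ a ≠ γ b ∧
  γ '' Icc a b ∩ segment ℝ (γ b) (γ a) = {γ a, γ b} ∧
  ∃ D : Set ℂ, IsOpen D ∧ D.Nonempty ∧ Bornology.IsBounded D ∧ Convex ℝ D ∧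
    frontier D = γ '' Icc a b ∪ segment ℝ (γ b) (γ a)

end PlaneCurve

/-- A support curve: a smooth, convex, simple, smoothly closed plane curve parametrized by
arclength and positively oriented. It is given through its periodic extension to `ℝ`, the period
being the length of the curve. -/
structure SupportCurve where
  /-- the periodic arclength parametrization -/
  f : ℝ → ℂ
  /-- the length of the curve -/
  len : ℝ
  len_pos : 0 < len
  smooth : ContDiff ℝ ∞ f
  periodic : Function.Periodic f len
  simple : InjOn f (Ico 0 len)
  unit_speed : ∀ s, ‖deriv f s‖ = 1
  /-- Convexity together with positive orientation: the curve lies in the closed half-plane to the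
  left of each of its oriented tangent lines. -/
  convex : ∀ s s₀, 0 ≤ inner ℝ (f s - f s₀) (Complex.I * deriv f s₀)

namespace SupportCurve

/-- The trace `Σ` of the support curve. -/
def trace (S : SupportCurve) : Set ℂ := range S.f

/-- The outer domain created by `Σ`: the points of the complement of `Σ` whose connected component
in that complement is unbounded. -/
def outerDomain (S : SupportCurve) : Set ℂ :=
  {x | x ∈ S.traceᶜ ∧ ¬ Bornology.IsBounded (connectedComponentIn S.traceᶜ x)}

/-- The curvature of the support curve with respect to the normal `J f'`. -/
def curvature (S : SupportCurve) (s : ℝ) : ℝ :=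
  inner ℝ (deriv (deriv S.f) s) (Complex.I * deriv S.f s)

/-- The maximum of the curvature of the support curve. -/
def curvatureMax (S : SupportCurve) : ℝ := sSup (range S.curvature)

/-- The number `min {|x - y| : x, y ∈ Σ with opposite unit tangents}`. -/
def width (S : SupportCurve) : ℝ :=
  sInf {d | ∃ s s' : ℝ, deriv S.f s = -deriv S.f s' ∧ d = ‖S.f s - S.f s'‖}

/-- The point `x` lies on `Σ`, and `θ` is the oriented angle from `v` to the unit tangent of `Σ`
at `x`. -/
def MeetsAtAngle (S : SupportCurve) (x v : ℂ) (θ : ℝ) : Prop :=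
  ∃ s, S.f s = x ∧ Complex.orientation.oangle v (deriv S.f s) = (θ : Real.Angle)

end SupportCurve

open PlaneCurve

/-- An initial curve `c₀ : [a,b] → ℝ²` for the support curve `S`. -/
structure IsInitialCurve (S : SupportCurve) (a b : ℝ) (c₀ : ℝ → ℂ) : Prop where
  lt : a < b
  smooth : ContDiffOn ℝ ∞ c₀ (Icc a b)
  regular : Regular a b c₀
  angle_left : S.MeetsAtAngle (c₀ a) (tangent a b c₀ a) (Real.pi / 2)
  angle_right : S.MeetsAtAngle (c₀ b) (tangent a b c₀ b) (-(Real.pi / 2))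

/-- The time interval `[0,T)`, where `T = ⊤` is allowed. -/
def timeInterval (T : EReal) : Set ℝ := {t : ℝ | 0 ≤ t ∧ (t : EReal) < T}

/-- `c : [a,b] × [0,T) → ℝ²` (written `c p t`) is a solution, with initial curve `c₀`, of the area
preserving curve shortening problem with Neumann free boundary conditions outside of `S`.
The family is smooth for positive times; at `t = 0` only continuity of `c`, `∂ₚc`, `∂ₚ²c` (hence,
by the equation, of `∂ₜc`) is required, since smoothness up to `t = 0` would force higher order
compatibility conditions on `c₀`. -/
structure IsSolution (S : SupportCurve) (a b : ℝ) (T : EReal) (c₀ : ℝ → ℂ) (c : ℝ → ℝ → ℂ) :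
    Prop where
  initial : IsInitialCurve S a b c₀
  time_pos : 0 < T
  smooth : ContDiffOn ℝ ∞ (fun x : ℝ × ℝ => c x.1 x.2)
    (Icc a b ×ˢ {t : ℝ | 0 < t ∧ (t : EReal) < T})
  continuous : ContinuousOn (fun x : ℝ × ℝ => c x.1 x.2) (Icc a b ×ˢ timeInterval T)
  continuous_velocity :
    ContinuousOn (fun x : ℝ × ℝ => velocity a b (c · x.2) x.1) (Icc a b ×ˢ timeInterval T)
  continuous_acceleration :
    ContinuousOn (fun x : ℝ × ℝ => acceleration a b (c · x.2) x.1) (Icc a b ×ˢ timeInterval T)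
  regular : ∀ t ∈ timeInterval T, Regular a b (c · t)
  evolution : ∀ p ∈ Icc a b, ∀ t ∈ timeInterval T,
    HasDerivWithinAt (c p)
      ((curvature a b (c · t) p - meanCurvature a b (c · t)) • normal a b (c · t) p)
      (timeInterval T) t
  initial_eq : ∀ p ∈ Icc a b, c p 0 = c₀ p
  angle_left : ∀ t ∈ timeInterval T,
    S.MeetsAtAngle (c a t) (tangent a b (c · t) a) (Real.pi / 2)
  angle_right : ∀ t ∈ timeInterval T,
    S.MeetsAtAngle (c b t) (tangent a b (c · t) b) (-(Real.pi / 2))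

end

noncomputable section

attribute [local instance] Complex.finrank_real_complex_fact

open PlaneCurve

/-! Write k for the maximal curvature of Σ, V = κ - κ̄, and α for the total curvature ∫ κ ds of a
curve of the flow. Embeddedness itself is never propagated in time. At each single time, κ > 0, L <
1/(2k) and α < 2π, together with the orthogonality at Σ, already force the curve and its chord to
bound a convex domain (`exists_convexArc`, `boundsConvexDomain`). It remains to preserve these three
properties.

The basic fact about Σ is a Blaschke rolling estimate (`one_sub_inner_deriv_le`): the height of Σ
over a tangent line, times k, dominates 1 - cos of the turning angle. Symmetrized, it says that the
Gauss map is co-coercive (`norm_deriv_sub_sq_le`).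

Length: dL/dt = -∫ V² ds ≤ 0. Positive curvature: a maximum principle for ∂ₜκ = κ_ss + Vκ². At a
boundary minimum, co-coercivity along the moving end point gives κ_s² ≤ ±k V κ_s, and the right side
has the wrong sign there, so κ_s = 0 and the minimum behaves like an interior one.

Total curvature: the end tangents of a short curve are those of Σ turned by right angles, so the
rolling estimate gives cos α < -1/2 (`cos_totalCurvature_lt`). Hence α never takes the value 2π, and
by continuity in time α < 2π only has to hold initially. There it follows from Hopf's secant
argument: the initial curve is embedded, and being short and outside Σ it cannot meet the inner
normal rays of Σ at its end points, so the secant direction turns by less than π along each of two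
edges of the parameter square.

Convexity: since Σ lies on one side of its tangents at the two end points, α ≥ π and the corners
with the chord are convex. A left-turning arc with this property lies strictly to the left of all
its tangent lines, which yields injectivity and identifies arc and chord with the boundary of the
convex hull. -/

lemma inner_I_mul_right (z w : ℂ) : inner ℝ z (Complex.I * w) = z.im * w.re - z.re * w.im := by
  simp [Complex.inner]; ring

lemma inner_eq_re_im (z w : ℂ) : inner ℝ z w = z.re * w.re + z.im * w.im := by
  simp [Complex.inner]; ring

/-- The last point before `x` at which a continuous function that is positive at `x` vanishes. -/
lemma exists_last_zero {g : ℝ → ℝ} (hg : Continuous g) {x z₀ : ℝ} (hx : 0 < g x) (hz₀ : z₀ ≤ x)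
    (h₀ : g z₀ ≤ 0) : ∃ z < x, g z = 0 ∧ ∀ y ∈ Ioc z x, 0 < g y := by
  set A : Set ℝ := {y | y ≤ x ∧ g y ≤ 0}
  have hA : IsClosed A := (isClosed_le continuous_id continuous_const).inter
    (isClosed_le hg continuous_const)
  have hne : A.Nonempty := ⟨z₀, hz₀, h₀⟩
  have hbdd : BddAbove A := ⟨x, fun y hy => hy.1⟩
  have hz : sSup A ∈ A := hA.csSup_mem hne hbdd
  have hpos : ∀ y ∈ Ioc (sSup A) x, 0 < g y := by
    intro y hy
    by_contra! h
    exact absurd (le_csSup hbdd (show y ∈ A from ⟨hy.2, h⟩)) (not_le.2 hy.1)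
  have hlt : sSup A < x := lt_of_le_of_ne hz.1 (fun h => by
    have := hz.2; rw [h] at this; linarith)
  refine ⟨sSup A, hlt, le_antisymm hz.2 ?_, hpos⟩
  have : (nhdsWithin (sSup A) (Ioi (sSup A))).NeBot := inferInstance
  refine ge_of_tendsto (hg.continuousWithinAt (s := Ioi (sSup A))) ?_
  filter_upwards [Ioc_mem_nhdsGT hlt] with y hy using (hpos y hy).le

/-- The first point after `x` at which a continuous function that is positive at `x` vanishes. -/
lemma exists_first_zero {g : ℝ → ℝ} (hg : Continuous g) {x z₀ : ℝ} (hx : 0 < g x) (hz₀ : x ≤ z₀)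
    (h₀ : g z₀ ≤ 0) : ∃ z, x < z ∧ g z = 0 ∧ ∀ y ∈ Ico x z, 0 < g y := by
  obtain ⟨z, hz, hz0, h⟩ := exists_last_zero (g := fun s => g (-s)) (by fun_prop) (x := -x)
    (z₀ := -z₀) (by simpa using hx) (by linarith) (by simpa using h₀)
  refine ⟨-z, by linarith, hz0, fun y hy => ?_⟩
  simpa using h (-y) ⟨by linarith [hy.2], by linarith [hy.1]⟩

/-! ### Differential geometry of the support curve: Frenet equations and the rolling estimate. -/

namespace SupportCurve

variable (S : SupportCurve)

lemma hasDerivAt_f (s : ℝ) : HasDerivAt S.f (deriv S.f s) s :=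
  ((S.smooth.differentiable (by simp)) s).hasDerivAt

lemma contDiff_deriv : ContDiff ℝ ∞ (deriv S.f) :=
  (contDiff_infty_iff_deriv.1 S.smooth).2

lemma continuous_deriv : Continuous (deriv S.f) := S.contDiff_deriv.continuous

lemma continuous_f : Continuous S.f := S.smooth.continuous

lemma normSq_deriv (s : ℝ) : (deriv S.f s).re ^ 2 + (deriv S.f s).im ^ 2 = 1 := by
  have := S.unit_speed s
  rw [Complex.norm_eq_sqrt_sq_add_sq, Real.sqrt_eq_one] at this
  exact this

lemma hasDerivAt_re (s : ℝ) : HasDerivAt (fun x => (S.f x).re) (deriv S.f s).re s :=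
  Complex.reCLM.hasFDerivAt.comp_hasDerivAt s (S.hasDerivAt_f s)

lemma hasDerivAt_im (s : ℝ) : HasDerivAt (fun x => (S.f x).im) (deriv S.f s).im s :=
  Complex.imCLM.hasFDerivAt.comp_hasDerivAt s (S.hasDerivAt_f s)

/-- Frenet equation: differentiating |f'|² = 1 removes the tangential part of f''. -/
lemma hasDerivAt_deriv (s : ℝ) :
    HasDerivAt (deriv S.f) (S.curvature s * (Complex.I * deriv S.f s)) s := by
  have h : HasDerivAt (deriv S.f) (deriv (deriv S.f) s) s :=
    ((S.contDiff_deriv.differentiable (by simp)) s).hasDerivAt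
  have hre : HasDerivAt (fun x => (deriv S.f x).re) (deriv (deriv S.f) s).re s :=
    Complex.reCLM.hasFDerivAt.comp_hasDerivAt s h
  have him : HasDerivAt (fun x => (deriv S.f x).im) (deriv (deriv S.f) s).im s :=
    Complex.imCLM.hasFDerivAt.comp_hasDerivAt s h
  have hc : HasDerivAt (fun x => (deriv S.f x).re ^ 2 + (deriv S.f x).im ^ 2) 0 s :=
    (hasDerivAt_const s (1 : ℝ)).congr_of_eventuallyEq
      (Filter.Eventually.of_forall fun x => S.normSq_deriv x)
  have h0 := ((hre.pow 2).add (him.pow 2)).unique hc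
  convert h using 1
  have h1 := S.normSq_deriv s
  simp only [Nat.cast_ofNat, Nat.add_one_sub_one, pow_one] at h0
  apply Complex.ext
  · simp only [curvature, inner_I_mul_right, Complex.mul_re, Complex.ofReal_re, Complex.I_re,
      Complex.I_im, Complex.ofReal_im]
    linear_combination (-(deriv (deriv S.f) s).re) * (-h1) - (deriv S.f s).re / 2 * h0
  · simp only [curvature, inner_I_mul_right, Complex.mul_im, Complex.ofReal_re, Complex.I_re,
      Complex.I_im, Complex.ofReal_im, Complex.mul_re]
    linear_combination (deriv (deriv S.f) s).im * h1 - (deriv S.f s).im / 2 * h0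

lemma hasDerivAt_deriv_re (s : ℝ) :
    HasDerivAt (fun x => (deriv S.f x).re) (-(S.curvature s * (deriv S.f s).im)) s := by
  refine (Complex.reCLM.hasFDerivAt.comp_hasDerivAt s (S.hasDerivAt_deriv s)).congr_deriv ?_
  simp

lemma hasDerivAt_deriv_im (s : ℝ) :
    HasDerivAt (fun x => (deriv S.f x).im) (S.curvature s * (deriv S.f s).re) s := by
  refine (Complex.imCLM.hasFDerivAt.comp_hasDerivAt s (S.hasDerivAt_deriv s)).congr_deriv ?_
  simp

lemma periodic_deriv : Function.Periodic (deriv S.f) S.len := by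
  intro s
  have : (fun x => S.f (x + S.len)) = S.f := funext S.periodic
  rw [← deriv_comp_add_const, this]

lemma periodic_curvature : Function.Periodic S.curvature S.len := by
  intro s
  have : deriv (deriv S.f) (s + S.len) = deriv (deriv S.f) s := by
    have : (fun x => deriv S.f (x + S.len)) = deriv S.f := funext S.periodic_deriv
    rw [← deriv_comp_add_const, this]
  simp only [curvature, this, S.periodic_deriv s]

lemma continuous_curvature : Continuous S.curvature := by
  have h2 : Continuous (deriv (deriv S.f)) :=
    (contDiff_infty_iff_deriv.1 S.contDiff_deriv).2.continuous
  exact h2.inner (continuous_const.mul S.continuous_deriv)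

lemma curvature_le_curvatureMax (s : ℝ) : S.curvature s ≤ S.curvatureMax :=
  le_csSup (S.periodic_curvature.compact_of_continuous S.len_pos.ne'
    S.continuous_curvature).bddAbove (mem_range_self s)

/-- The height over the tangent line at `s₀` is bounded below in terms of the turning of the
tangent and the maximal curvature (the disk of radius `1 / κ_max` rolls inside the curve). -/
theorem one_sub_inner_deriv_le (s₀ s : ℝ) :
    1 - inner ℝ (deriv S.f s) (deriv S.f s₀) ≤
      S.curvatureMax * inner ℝ (S.f s - S.f s₀) (Complex.I * deriv S.f s₀) := by
  set k := S.curvatureMax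
  set τ := deriv S.f s₀ with hτ
  set y : ℝ → ℝ := fun s => inner ℝ (S.f s - S.f s₀) (Complex.I * τ) with hy
  set c : ℝ → ℝ := fun s => inner ℝ (deriv S.f s) τ with hc
  set σ : ℝ → ℝ := fun s => inner ℝ (deriv S.f s) (Complex.I * τ) with hσ
  have hτ1 : τ.re ^ 2 + τ.im ^ 2 = 1 := S.normSq_deriv s₀
  have hcσ : ∀ s, c s ^ 2 + σ s ^ 2 = 1 := by
    intro s
    have := S.normSq_deriv s
    simp only [hc, hσ, ↓inner_I_mul_right, inner_eq_re_im]
    linear_combination (τ.re ^ 2 + τ.im ^ 2) * this + hτ1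
  have hdy : ∀ s, HasDerivAt y (σ s) s := by
    intro s
    simp only [hy, hσ, inner_I_mul_right, Complex.sub_re, Complex.sub_im]
    exact (((S.hasDerivAt_im s).sub_const _).mul_const _).sub
      (((S.hasDerivAt_re s).sub_const _).mul_const _)
  -- For a circle of radius 1/k this function vanishes identically. In general its derivative (k -
  -- κ)σ has the sign of y' = σ.
  set h : ℝ → ℝ := fun s => k * y s - (1 - c s) with hh
  have hdh : ∀ s, HasDerivAt h ((k - S.curvature s) * σ s) s := by
    intro s
    have hdc : HasDerivAt c (-(S.curvature s * σ s)) s := by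
      simp only [hc, hσ, ↓inner_I_mul_right, inner_eq_re_im]
      refine (((S.hasDerivAt_deriv_re s).mul_const τ.re).add
        ((S.hasDerivAt_deriv_im s).mul_const τ.im)).congr_deriv ?_
      ring
    refine (((hdy s).const_mul k).sub (hdc.const_sub 1)).congr_deriv ?_
    ring
  have hk : ∀ s, 0 ≤ k - S.curvature s := fun s => sub_nonneg.2 (S.curvature_le_curvatureMax s)
  have hycont : Continuous y := continuous_iff_continuousAt.2 fun s => (hdy s).continuousAt
  have hhcont : Continuous h := continuous_iff_continuousAt.2 fun s => (hdh s).continuousAt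
  have hσcont : Continuous σ := S.continuous_deriv.inner continuous_const
  have heq : ∀ s, c s = 1 → deriv S.f s = τ := by
    intro s hs
    have h1 := S.normSq_deriv s
    simp only [hc, inner_eq_re_im] at hs
    have : ((deriv S.f s).re - τ.re) ^ 2 + ((deriv S.f s).im - τ.im) ^ 2 = 0 := by
      linear_combination h1 + hτ1 - 2 * hs
    apply Complex.ext <;> nlinarith [sq_nonneg ((deriv S.f s).re - τ.re),
      sq_nonneg ((deriv S.f s).im - τ.im)]
  have hneg : ∀ s, c s = -1 → deriv S.f s = -τ := by
    intro s hs
    have h1 := S.normSq_deriv s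
    simp only [hc, inner_eq_re_im] at hs
    have : ((deriv S.f s).re + τ.re) ^ 2 + ((deriv S.f s).im + τ.im) ^ 2 = 0 := by
      linear_combination h1 + hτ1 + 2 * hs
    apply Complex.ext <;> simp <;> nlinarith [sq_nonneg ((deriv S.f s).re + τ.re),
      sq_nonneg ((deriv S.f s).im + τ.im)]
  have hy0 : ∀ s, 0 ≤ y s := fun s => S.convex s s₀
  -- Two points with the same tangent lie to the left of each other's tangent lines, so these lines
  -- coincide.
  have hone : ∀ s, c s = 1 → h s = 0 := by
    intro s hs
    have h1 := S.convex s₀ s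
    rw [heq s hs] at h1
    have h2 : y s = -inner ℝ (S.f s₀ - S.f s) (Complex.I * τ) := by
      rw [hy, ← inner_neg_left, neg_sub]
    have : y s = 0 := le_antisymm (by linarith) (hy0 s)
    simp [hh, this, hs]
  -- Where the tangent is opposite, the half-plane condition bounds the height from above.
  have hmax : ∀ s, c s = -1 → ∀ s', y s' ≤ y s := by
    intro s hs s'
    have h1 := S.convex s' s
    rw [hneg s hs, mul_neg, inner_neg_right] at h1
    have : y s' - y s = inner ℝ (S.f s' - S.f s) (Complex.I * τ) := by
      rw [hy, ← inner_sub_left]; congr 1; ring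
    linarith
  have hcases : ∀ s, σ s = 0 → c s = 1 ∨ c s = -1 := by
    intro s hs
    have := hcσ s
    rw [hs] at this
    exact sq_eq_sq_iff_eq_or_eq_neg.1 (by linarith)
  -- The translates of s₀ by periods supply zeros on both sides of any parameter, so last and first
  -- zeros exist.
  have hσn : ∀ n : ℤ, σ (s₀ + n * S.len) = 0 ∧ h (s₀ + n * S.len) = 0 := by
    intro n
    have h1 : deriv S.f (s₀ + n * S.len) = τ := by
      simpa using S.periodic_deriv.int_mul n s₀
    refine ⟨?_, hone _ ?_⟩
    · simp [hσ, h1]; ring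
    · simp only [hc, h1, inner_eq_re_im]; linarith
  have hbelow : ∀ x, ∃ n : ℤ, s₀ + n * S.len ≤ x := by
    intro x
    obtain ⟨n, hn⟩ := exists_int_lt ((x - s₀) / S.len)
    refine ⟨n, ?_⟩
    rw [lt_div_iff₀ S.len_pos] at hn
    linarith
  have habove : ∀ x, ∃ n : ℤ, x ≤ s₀ + n * S.len := by
    intro x
    obtain ⟨n, hn⟩ := exists_int_gt ((x - s₀) / S.len)
    refine ⟨n, ?_⟩
    rw [div_lt_iff₀ S.len_pos] at hn
    linarith
  -- From the last zero z of σ the height increases strictly, so z is not a highest point. Hence the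
  -- tangent at z is τ, h z = 0, and h increases from z to s.
  have hpos : ∀ s, 0 < σ s → 0 ≤ h s := by
    intro s hs
    obtain ⟨n, hn⟩ := hbelow s
    obtain ⟨z, hz, hz0, hzs⟩ := exists_last_zero hσcont hs hn (hσn n).1.le
    have hmono : StrictMonoOn y (Icc z s) := strictMonoOn_of_deriv_pos (convex_Icc _ _)
      hycont.continuousOn (fun x hx => by
        rw [interior_Icc] at hx; rw [(hdy x).deriv]; exact hzs x ⟨hx.1, hx.2.le⟩)
    have hlt := hmono (left_mem_Icc.2 hz.le) (right_mem_Icc.2 hz.le) hz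
    have hz1 : h z = 0 := hone z ((hcases z hz0).resolve_right fun h => by
      linarith [hmax z h s])
    have hmonoh : MonotoneOn h (Icc z s) := monotoneOn_of_deriv_nonneg (convex_Icc _ _)
      hhcont.continuousOn (fun x _ => (hdh x).differentiableAt.differentiableWithinAt)
      (fun x hx => by
        rw [interior_Icc] at hx; rw [(hdh x).deriv]
        exact mul_nonneg (hk x) (hzs x ⟨hx.1, hx.2.le⟩).le)
    have := hmonoh (left_mem_Icc.2 hz.le) (right_mem_Icc.2 hz.le) hz.le
    linarith
  have hnegσ : ∀ s, σ s < 0 → 0 ≤ h s := by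
    intro s hs
    obtain ⟨n, hn⟩ := habove s
    obtain ⟨z, hz, hz0, hzs⟩ := exists_first_zero (g := fun x => -σ x) hσcont.neg
      (by simpa using hs) hn (by simp [(hσn n).1])
    have hmono : StrictAntiOn y (Icc s z) := strictAntiOn_of_deriv_neg (convex_Icc _ _)
      hycont.continuousOn (fun x hx => by
        rw [interior_Icc] at hx; rw [(hdy x).deriv]; linarith [hzs x ⟨hx.1.le, hx.2⟩])
    have hlt := hmono (left_mem_Icc.2 hz.le) (right_mem_Icc.2 hz.le) hz
    have hz1 : h z = 0 := hone z ((hcases z (by linarith)).resolve_right fun h => by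
      linarith [hmax z h s])
    have hmonoh : AntitoneOn h (Icc s z) := antitoneOn_of_deriv_nonpos (convex_Icc _ _)
      hhcont.continuousOn (fun x _ => (hdh x).differentiableAt.differentiableWithinAt)
      (fun x hx => by
        rw [interior_Icc] at hx; rw [(hdh x).deriv]
        exact mul_nonpos_of_nonneg_of_nonpos (hk x) (by linarith [hzs x ⟨hx.1.le, hx.2⟩]))
    have := hmonoh (left_mem_Icc.2 hz.le) (right_mem_Icc.2 hz.le) hz.le
    linarith
  suffices hgoal : 0 ≤ h s by
    simp only [hh] at hgoal; linarith
  -- Only σ s = 0 is left. Wherever h < 0 the two sign cases force σ = 0, so h is constant back to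
  -- its last zero.
  by_contra! hs
  obtain ⟨n, hn⟩ := hbelow s
  obtain ⟨z, hz, hz0, hzs⟩ := exists_last_zero (g := fun x => -h x) hhcont.neg
    (by simpa using hs) hn (by simp [(hσn n).2])
  have hσ0 : ∀ x ∈ Ioc z s, σ x = 0 := by
    intro x hx
    have h1 := hzs x hx
    rcases lt_trichotomy (σ x) 0 with h2 | h2 | h2
    · linarith [hnegσ x h2]
    · exact h2
    · linarith [hpos x h2]
  have hmonoh : MonotoneOn h (Icc z s) := monotoneOn_of_deriv_nonneg (convex_Icc _ _)
    hhcont.continuousOn (fun x _ => (hdh x).differentiableAt.differentiableWithinAt)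
    (fun x hx => by
      rw [interior_Icc] at hx; rw [(hdh x).deriv, hσ0 x ⟨hx.1, hx.2.le⟩]; simp)
  have := hmonoh (left_mem_Icc.2 hz.le) (right_mem_Icc.2 hz.le) hz.le
  linarith

lemma norm_deriv_sub_sq (s s' : ℝ) : ‖deriv S.f s - deriv S.f s'‖ ^ 2 =
    2 * (1 - inner ℝ (deriv S.f s) (deriv S.f s')) := by
  rw [norm_sub_sq_real, S.unit_speed, S.unit_speed]; ring

/-- The Gauss map of the support curve is co-coercive. -/
theorem norm_deriv_sub_sq_le (s s' : ℝ) : ‖deriv S.f s - deriv S.f s'‖ ^ 2 ≤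
    S.curvatureMax * inner ℝ (S.f s - S.f s') (Complex.I * (deriv S.f s' - deriv S.f s)) := by
  -- The rolling estimate is added to itself with the two points exchanged.
  have h1 := S.one_sub_inner_deriv_le s s'
  have h2 := S.one_sub_inner_deriv_le s' s
  rw [real_inner_comm] at h1
  have h3 : inner ℝ (S.f s' - S.f s) (Complex.I * deriv S.f s) =
      -inner ℝ (S.f s - S.f s') (Complex.I * deriv S.f s) := by
    rw [← inner_neg_left, neg_sub]
  rw [norm_deriv_sub_sq, mul_sub Complex.I, inner_sub_right, mul_sub S.curvatureMax]
  rw [h3] at h1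
  linarith

/-- The tangent of the support curve is not constant. -/
lemma exists_deriv_ne (s₀ : ℝ) : ∃ s, deriv S.f s ≠ deriv S.f s₀ := by
  by_contra! h
  have h1 : ∀ s, HasDerivAt (fun x => S.f x - (x : ℂ) * deriv S.f s₀) 0 s := by
    intro s
    have h2 : HasDerivAt (fun x : ℝ => (x : ℂ) * deriv S.f s₀) (1 * deriv S.f s₀) s :=
      (Complex.ofRealCLM.hasDerivAt (x := s)).mul_const _
    refine ((S.hasDerivAt_f s).sub h2).congr_deriv ?_
    rw [h s, one_mul, sub_self]
  have h2 := is_const_of_deriv_eq_zero (fun s => (h1 s).differentiableAt)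
    (fun s => (h1 s).deriv) 0 S.len
  have h3 : S.f S.len = S.f 0 := by simpa using S.periodic 0
  rw [h3] at h2
  have h4 : (S.len : ℂ) * deriv S.f s₀ = 0 := by
    simp only [Complex.ofReal_zero] at h2
    linear_combination h2
  rcases mul_eq_zero.1 h4 with h5 | h5
  · exact S.len_pos.ne' (by exact_mod_cast h5)
  · have := S.unit_speed s₀
    simp [h5] at this

lemma deriv_eq_of_one_le_inner {s s' : ℝ} (h : 1 ≤ inner ℝ (deriv S.f s) (deriv S.f s')) :
    deriv S.f s = deriv S.f s' := by
  have := S.norm_deriv_sub_sq s s'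
  have h2 : ‖deriv S.f s - deriv S.f s'‖ ^ 2 ≤ 0 := by linarith
  have h3 : ‖deriv S.f s - deriv S.f s'‖ = 0 := by
    nlinarith [norm_nonneg (deriv S.f s - deriv S.f s')]
  exact sub_eq_zero.1 (norm_eq_zero.1 h3)

/-- If k ≤ 0, the rolling estimate would make the tangent constant. -/
theorem curvatureMax_pos : 0 < S.curvatureMax := by
  obtain ⟨s, hs⟩ := S.exists_deriv_ne 0
  by_contra! h
  apply hs
  apply S.deriv_eq_of_one_le_inner
  have := S.one_sub_inner_deriv_le 0 s
  nlinarith [S.convex s 0]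

/-- The curvature is the second derivative at s₀ of the height over the tangent line there. If it
were negative, the nonnegative height would have a local maximum with value zero, hence vanish near
s₀. -/
lemma curvature_nonneg (s₀ : ℝ) : 0 ≤ S.curvature s₀ := by
  by_contra! h
  set τ := deriv S.f s₀ with hτ
  set y : ℝ → ℝ := fun s => inner ℝ (S.f s - S.f s₀) (Complex.I * τ) with hy
  have hdy : deriv y = fun s => inner ℝ (deriv S.f s) (Complex.I * τ) := by
    funext s
    refine HasDerivAt.deriv ?_
    simp only [hy, inner_I_mul_right, Complex.sub_re, Complex.sub_im]
    exact (((S.hasDerivAt_im s).sub_const _).mul_const _).sub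
      (((S.hasDerivAt_re s).sub_const _).mul_const _)
  have hddy : deriv (deriv y) s₀ = S.curvature s₀ := by
    rw [hdy]
    refine HasDerivAt.deriv ?_
    simp only [inner_I_mul_right]
    refine (((S.hasDerivAt_deriv_im s₀).mul_const τ.re).sub
      ((S.hasDerivAt_deriv_re s₀).mul_const τ.im)).congr_deriv ?_
    linear_combination (S.curvature s₀) * S.normSq_deriv s₀
  have hy0 : deriv y s₀ = 0 := by
    rw [hdy]; simp only [inner_I_mul_right, ← hτ]; ring
  have hycont : Continuous y :=
    (S.continuous_f.sub continuous_const).inner continuous_const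
  have hmax := isLocalMax_of_deriv_deriv_neg (by rw [hddy]; exact h) hy0 hycont.continuousAt
  have hconst : y =ᶠ[nhds s₀] fun _ => 0 := by
    filter_upwards [hmax] with s hs
    have h1 : y s₀ = 0 := by simp [hy]
    exact le_antisymm (h1 ▸ hs) (S.convex s s₀)
  have := hconst.deriv.deriv_eq
  rw [hddy] at this
  simp at this
  linarith

/-! ### The convex region of Σ and its separation from the outer domain. -/

/-- The closed convex region bounded by the support curve. -/
def region : Set ℂ := {z | ∀ s, 0 ≤ inner ℝ (z - S.f s) (Complex.I * deriv S.f s)}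

/-- A point of the region that lies on a tangent line lies on the curve. -/
lemma mem_trace_of_inner_eq_zero {z : ℂ} (hz : z ∈ S.region) {s₀ : ℝ}
    (h₀ : inner ℝ (z - S.f s₀) (Complex.I * deriv S.f s₀) = 0) : z ∈ S.trace := by
  -- Here g and l are the coordinates of z in the moving frame of Σ, so that g' = -κ l and l' = -1 +
  -- κ g.
  set g : ℝ → ℝ := fun s => inner ℝ (z - S.f s) (Complex.I * deriv S.f s) with hg
  set l : ℝ → ℝ := fun s => inner ℝ (z - S.f s) (deriv S.f s) with hl
  have hdg : ∀ s, HasDerivAt g (-S.curvature s * l s) s := by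
    intro s
    simp only [hg, hl, ↓inner_I_mul_right, inner_eq_re_im, Complex.sub_re, Complex.sub_im]
    refine ((((S.hasDerivAt_im s).const_sub z.im).mul (S.hasDerivAt_deriv_re s)).sub
      (((S.hasDerivAt_re s).const_sub z.re).mul (S.hasDerivAt_deriv_im s))).congr_deriv ?_
    ring
  have hdl : ∀ s, HasDerivAt l (-1 + S.curvature s * g s) s := by
    intro s
    simp only [hg, hl, ↓inner_I_mul_right, inner_eq_re_im, Complex.sub_re, Complex.sub_im]
    refine ((((S.hasDerivAt_re s).const_sub z.re).mul (S.hasDerivAt_deriv_re s)).add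
      (((S.hasDerivAt_im s).const_sub z.im).mul (S.hasDerivAt_deriv_im s))).congr_deriv ?_
    linear_combination (-1 : ℝ) * S.normSq_deriv s
  have hgc : Continuous g := continuous_iff_continuousAt.2 fun s => (hdg s).continuousAt
  have hκ := S.curvature_nonneg
  have hmono : Monotone fun s => l s + s := by
    have hd : ∀ s, HasDerivAt (fun s => l s + s) (S.curvature s * g s) s := by
      intro s
      refine ((hdl s).add (hasDerivAt_id s)).congr_deriv ?_
      ring
    exact monotone_of_deriv_nonneg (fun s => (hd s).differentiableAt)
      (fun s => by rw [(hd s).deriv]; exact mul_nonneg (hκ s) (hz s))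
  have hend : ∀ s, g s = 0 → l s = 0 → z ∈ S.trace := by
    intro s h1 h2
    refine ⟨s, ?_⟩
    have h3 := S.normSq_deriv s
    simp only [hg, hl, ↓inner_I_mul_right, inner_eq_re_im, Complex.sub_re, Complex.sub_im] at h1 h2
    apply Complex.ext
    · linear_combination (z.re - (S.f s).re) * h3 - (deriv S.f s).re * h2 +
        (deriv S.f s).im * h1
    · linear_combination (z.im - (S.f s).im) * h3 - (deriv S.f s).im * h2 -
        (deriv S.f s).re * h1
  have hanti : ∀ s, g s = 0 → ∀ s', g s' = 0 → (∀ x ∈ uIcc s s', g x = 0) →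
      l s' + s' = l s + s := by
    intro s _ s' _ h
    have hd : ∀ x ∈ uIcc s s', HasDerivWithinAt (fun s => l s + s) 0 (uIcc s s') x := by
      intro x hx
      have := ((hdl x).add (hasDerivAt_id x)).hasDerivWithinAt (s := uIcc s s')
      rw [h x hx] at this
      refine (this).congr_deriv ?_
      ring
    have := (convex_uIcc s s').norm_image_sub_le_of_norm_hasDerivWithin_le (C := 0) hd
      (fun x _ => by simp) left_mem_uIcc right_mem_uIcc
    rw [zero_mul, norm_le_zero_iff, sub_eq_zero] at this
    exact this
  rcases le_total 0 (l s₀) with hl0 | hl0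
  -- If Σ runs straight towards z, it arrives after the length l s₀. Monotonicity of l + s keeps l ≥
  -- 0 up to s₁, so g ≥ 0 decreases from 0 and vanishes there. Then l + s is constant, and both
  -- coordinates vanish at s₁.
  · set s₁ := s₀ + l s₀
    have hle : s₀ ≤ s₁ := by simp [s₁, hl0]
    have hlpos : ∀ x ∈ Icc s₀ s₁, 0 ≤ l x := by
      intro x hx
      have := hmono hx.1
      simp only at this
      have := hx.2
      simp only [s₁] at this
      linarith
    have hganti : AntitoneOn g (Icc s₀ s₁) := antitoneOn_of_deriv_nonpos (convex_Icc _ _)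
      hgc.continuousOn (fun x _ => (hdg x).differentiableAt.differentiableWithinAt)
      (fun x hx => by
        rw [(hdg x).deriv]
        have := mul_nonneg (hκ x) (hlpos x (interior_subset hx))
        linarith)
    have hg0 : ∀ x ∈ Icc s₀ s₁, g x = 0 := fun x hx => le_antisymm
      (h₀ ▸ hganti (left_mem_Icc.2 hle) hx hx.1) (hz x)
    have hg1 := hg0 s₁ (right_mem_Icc.2 hle)
    have := hanti s₀ h₀ s₁ hg1 (by rw [uIcc_of_le hle]; exact hg0)
    exact hend s₁ hg1 (by simp only [s₁] at this ⊢; linarith)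
  · set s₁ := s₀ + l s₀
    have hle : s₁ ≤ s₀ := by simp [s₁, hl0]
    have hlneg : ∀ x ∈ Icc s₁ s₀, l x ≤ 0 := by
      intro x hx
      have := hmono hx.2
      simp only at this
      have := hx.1
      simp only [s₁] at this
      linarith
    have hgmono : MonotoneOn g (Icc s₁ s₀) := monotoneOn_of_deriv_nonneg (convex_Icc _ _)
      hgc.continuousOn (fun x _ => (hdg x).differentiableAt.differentiableWithinAt)
      (fun x hx => by
        rw [(hdg x).deriv]
        have := mul_nonneg (hκ x) (neg_nonneg.2 (hlneg x (interior_subset hx)))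
        linarith)
    have hg0 : ∀ x ∈ Icc s₁ s₀, g x = 0 := fun x hx => le_antisymm
      (h₀ ▸ hgmono hx (right_mem_Icc.2 hle) hx.2) (hz x)
    have hg1 := hg0 s₁ (left_mem_Icc.2 hle)
    have := hanti s₀ h₀ s₁ hg1 (by rw [uIcc_of_ge hle]; exact hg0)
    exact hend s₁ hg1 (by simp only [s₁] at this ⊢; linarith)

lemma isClosed_region : IsClosed S.region := by
  have : S.region = ⋂ s, {z | 0 ≤ inner ℝ (z - S.f s) (Complex.I * deriv S.f s)} := by
    ext z; simp [region]
  rw [this]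
  exact isClosed_iInter fun s => isClosed_le continuous_const (by fun_prop)

/-- Strict inequalities over a compact set of parameters define an open set. -/
lemma region_diff_trace : S.region \ S.trace =
    {z | ∀ s ∈ Icc 0 S.len, 0 < inner ℝ (z - S.f s) (Complex.I * deriv S.f s)} := by
  ext z
  constructor
  · rintro ⟨h1, h2⟩ s _
    exact lt_of_le_of_ne (h1 s) fun h => h2 (S.mem_trace_of_inner_eq_zero h1 h.symm)
  · intro h
    have h' : ∀ s, 0 < inner ℝ (z - S.f s) (Complex.I * deriv S.f s) := by
      intro s
      have hp : Function.Periodic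
          (fun s => inner ℝ (z - S.f s) (Complex.I * deriv S.f s)) S.len := by
        intro s; simp only [S.periodic s, S.periodic_deriv s]
      obtain ⟨y, hy, hys⟩ := hp.exists_mem_Ico₀ S.len_pos s
      rw [hys]
      exact h y ⟨hy.1, hy.2.le⟩
    refine ⟨fun s => (h' s).le, ?_⟩
    rintro ⟨s, rfl⟩
    simpa using h' s

lemma isOpen_region_diff_trace : IsOpen (S.region \ S.trace) := by
  rw [region_diff_trace]
  have hc : Continuous (fun p : ℂ × ℝ =>
      (inner ℝ (p.1 - S.f p.2) (Complex.I * deriv S.f p.2) : ℝ)) := by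
    have h1 := S.continuous_f
    have h2 := S.continuous_deriv
    fun_prop
  rw [isOpen_iff_mem_nhds]
  intro z hz
  have h1 : ∀ s ∈ Icc 0 S.len, ∀ᶠ p : ℂ × ℝ in nhds z ×ˢ nhds s,
      0 < (inner ℝ (p.1 - S.f p.2) (Complex.I * deriv S.f p.2) : ℝ) := by
    intro s hs
    rw [← nhds_prod_eq]
    exact hc.continuousAt.eventually_const_lt (hz s hs)
  have h2 := isCompact_Icc.eventually_forall_of_forall_eventually (x₀ := z) (K := Icc 0 S.len)
    (P := fun z s => 0 < (inner ℝ (z - S.f s) (Complex.I * deriv S.f s) : ℝ))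
    (fun s hs => by rw [nhds_prod_eq]; exact h1 s hs)
  exact h2

lemma isBounded_trace : Bornology.IsBounded S.trace :=
  (S.periodic.compact_of_continuous S.len_pos.ne' S.continuous_f).isBounded

lemma isBounded_region : Bornology.IsBounded S.region := by
  obtain ⟨M, hM⟩ := S.isBounded_trace.exists_norm_le
  refine (Metric.isBounded_closedBall (x := (0 : ℂ)) (r := M)).subset fun z hz => ?_
  rw [mem_closedBall_zero_iff]
  rcases eq_or_ne z 0 with rfl | hz0
  · simpa using (norm_nonneg _).trans (hM (S.f 0) ⟨0, rfl⟩)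
  -- At a point of Σ that is extremal in the direction of z, the normal is parallel to z, and the
  -- half-plane condition there bounds the norm of z.
  obtain ⟨s, -, hs⟩ := (isCompact_Icc (a := (0 : ℝ)) (b := S.len)).exists_isMaxOn
    ⟨0, left_mem_Icc.2 S.len_pos.le⟩
    (f := fun s => (inner ℝ (S.f s) z : ℝ))
    (S.continuous_f.inner continuous_const).continuousOn
  have hmax : ∀ s', (inner ℝ (S.f s') z : ℝ) ≤ inner ℝ (S.f s) z := by
    intro s'
    obtain ⟨y, hy, hys⟩ := S.periodic.exists_mem_Ico₀ S.len_pos s'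
    rw [hys]
    exact hs ⟨hy.1, hy.2.le⟩
  have hd : HasDerivAt (fun s => (inner ℝ (S.f s) z : ℝ)) (inner ℝ (deriv S.f s) z) s := by
    simp only [inner_eq_re_im]
    exact ((S.hasDerivAt_re s).mul_const _).add ((S.hasDerivAt_im s).mul_const _)
  have h0 : (inner ℝ (deriv S.f s) z : ℝ) = 0 :=
    (IsLocalMax.hasDerivAt_eq_zero (Filter.Eventually.of_forall hmax) hd)
  have hn := S.normSq_deriv s
  set r : ℝ := inner ℝ z (Complex.I * deriv S.f s) with hr
  have hzr : z = r * (Complex.I * deriv S.f s) := by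
    simp only [inner_eq_re_im] at h0
    apply Complex.ext
    · simp [hr]
      linear_combination (-z.re) * hn + (deriv S.f s).re * h0
    · simp [hr]
      linear_combination (-z.im) * hn + (deriv S.f s).im * h0
  have hin : ∀ s', (inner ℝ (S.f s') z : ℝ) = r * inner ℝ (S.f s') (Complex.I * deriv S.f s) := by
    intro s'
    conv_lhs => rw [hzr]
    rw [← Complex.real_smul, real_inner_smul_right]
  have hnorm : ‖z‖ = |r| := by
    conv_lhs => rw [hzr]
    simp [S.unit_speed]
  -- If the inner normal pointed along z, maximality and convexity would give height zero
  -- throughout, and the tangent would be constant.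
  have hrneg : r < 0 := by
    by_contra! hr0
    have hrpos : 0 < r := lt_of_le_of_ne hr0 fun h => hz0 (by rw [hzr, ← h]; simp)
    obtain ⟨s', hs'⟩ := S.exists_deriv_ne s
    apply hs'
    apply S.deriv_eq_of_one_le_inner
    have h1 := S.one_sub_inner_deriv_le s s'
    have h2 := hmax s'
    rw [hin, hin] at h2
    have h3 := le_of_mul_le_mul_left h2 hrpos
    have h4 := S.convex s' s
    rw [inner_sub_left] at h1 h4
    have h5 : (inner ℝ (S.f s') (Complex.I * deriv S.f s) : ℝ) -
      inner ℝ (S.f s) (Complex.I * deriv S.f s) = 0 := by linarith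
    rw [h5] at h1
    linarith
  have h6 := hz s
  rw [inner_sub_left] at h6
  have h7 := (abs_real_inner_le_norm (S.f s) (Complex.I * deriv S.f s))
  have h8 := hM (S.f s) ⟨s, rfl⟩
  simp only [norm_mul, Complex.norm_I, S.unit_speed, mul_one] at h7
  rw [hnorm, abs_of_neg hrneg]
  have := neg_abs_le (inner ℝ (S.f s) (Complex.I * deriv S.f s) : ℝ)
  linarith

/-- No point of the region belongs to the outer domain. -/
theorem notMem_outerDomain {z : ℂ} (hz : z ∈ S.region) : z ∉ S.outerDomain := by
  rintro ⟨h1, h2⟩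
  apply h2
  refine S.isBounded_region.subset ?_
  have hpre : IsPreconnected (connectedComponentIn S.traceᶜ z) := isPreconnected_connectedComponentIn
  -- Off the trace, inside and outside of the region are disjoint open sets, so a connected set that
  -- starts inside stays in the bounded region.
  have hsub : connectedComponentIn S.traceᶜ z ⊆ (S.region \ S.trace) ∪ S.regionᶜ := by
    intro w hw
    have := connectedComponentIn_subset _ _ hw
    by_cases h : w ∈ S.region
    · exact Or.inl ⟨h, this⟩
    · exact Or.inr h
  have := hpre.subset_left_of_subset_union S.isOpen_region_diff_trace
    S.isClosed_region.isOpen_compl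
    (disjoint_compl_right.mono_left sdiff_subset) hsub
    ⟨z, mem_connectedComponentIn h1, hz, h1⟩
  exact this.trans sdiff_subset

/-- The points at small distance from the curve along the inner normal lie in the region. -/
lemma add_normal_mem_region (s : ℝ) {r : ℝ} (hr : 0 ≤ r) (hrk : S.curvatureMax * r ≤ 1) :
    S.f s + r * (Complex.I * deriv S.f s) ∈ S.region := by
  intro s₀
  have h1 := S.one_sub_inner_deriv_le s₀ s
  have h2 : (inner ℝ (S.f s + r * (Complex.I * deriv S.f s) - S.f s₀)
      (Complex.I * deriv S.f s₀) : ℝ) =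
      inner ℝ (S.f s - S.f s₀) (Complex.I * deriv S.f s₀) +
        r * inner ℝ (deriv S.f s) (deriv S.f s₀) := by
    simp only [↓inner_I_mul_right, inner_eq_re_im]
    simp
    ring
  rw [h2]
  set c : ℝ := inner ℝ (deriv S.f s) (deriv S.f s₀)
  set y : ℝ := inner ℝ (S.f s - S.f s₀) (Complex.I * deriv S.f s₀)
  have hk := S.curvatureMax_pos
  -- For c ≤ 0 the rolling estimate gives k (y + r c) ≥ 1 - c + k r c ≥ 1.
  rcases le_total 0 c with hc | hc
  · have := S.convex s s₀
    positivity
  · refine nonneg_of_mul_nonneg_right ?_ hk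
    nlinarith [mul_nonneg (sub_nonneg.2 hrk) (neg_nonneg.2 hc)]

/-- Source of the constant 1/(2k): the height is at most the distance, so k times the height is
below 1/2. -/
lemma half_lt_inner_deriv {s s₀ : ℝ} (h : ‖S.f s - S.f s₀‖ < 1 / (2 * S.curvatureMax)) :
    1 / 2 < (inner ℝ (deriv S.f s) (deriv S.f s₀) : ℝ) := by
  have h1 := S.one_sub_inner_deriv_le s₀ s
  have hk := S.curvatureMax_pos
  have h2 := real_inner_le_norm (S.f s - S.f s₀) (Complex.I * deriv S.f s₀)
  simp only [norm_mul, Complex.norm_I, S.unit_speed, mul_one] at h2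
  rw [lt_div_iff₀ (by positivity)] at h
  nlinarith

end SupportCurve

/-! ### Convex hulls and supporting functionals. -/

/-- The convex hull of a compact subset of a finite-dimensional space is compact. -/
theorem isCompact_convexHull_of_isCompact {E : Type*} [NormedAddCommGroup E] [NormedSpace ℝ E]
    [FiniteDimensional ℝ E] {s : Set E} (hs : IsCompact s) : IsCompact (convexHull ℝ s) := by
  rcases s.eq_empty_or_nonempty with rfl | ⟨x₀, hx₀⟩
  · simp
  -- By Carathéodory's theorem this many points suffice, so the hull is a continuous image of a
  -- compact set.
  set n := Module.finrank ℝ E + 1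
  have himage : convexHull ℝ s = (fun q : (Fin n → ℝ) × (Fin n → E) => ∑ i, q.1 i • q.2 i) ''
      (stdSimplex ℝ (Fin n) ×ˢ Set.univ.pi fun _ => s) := by
    apply Subset.antisymm
    · intro x hx
      obtain ⟨ι, hι, z, w, hz, hind, hw, hw1, hx⟩ := eq_pos_convex_span_of_mem_convexHull hx
      have hcard : Fintype.card ι ≤ Fintype.card (Fin n) := by
        simpa [n] using hind.card_le_finrank_succ.trans
          (Nat.succ_le_succ (Submodule.finrank_le _))
      obtain ⟨e⟩ := Function.Embedding.nonempty_of_card_le hcard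
      -- Combinations of fewer points are padded by copies of x₀ with weight zero.
      refine ⟨(Function.extend e w 0, Function.extend e z fun _ => x₀), ⟨⟨?_, ?_⟩, ?_⟩, ?_⟩
      · intro j
        by_cases hj : ∃ i, e i = j
        · obtain ⟨i, rfl⟩ := hj
          simpa [e.injective.extend_apply] using (hw i).le
        · simp [Function.extend_apply' _ _ _ hj]
      · rw [← hw1]
        refine (Fintype.sum_of_injective e e.injective _ _ (fun j hj => ?_) fun i => ?_).symm
        · exact Function.extend_apply' _ _ _ hj
        · simp only [e.injective.extend_apply]
      · intro j _
        by_cases hj : ∃ i, e i = j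
        · obtain ⟨i, rfl⟩ := hj
          simpa [e.injective.extend_apply] using hz (mem_range_self i)
        · simpa [Function.extend_apply' _ _ _ hj] using hx₀
      · rw [← hx]
        refine (Fintype.sum_of_injective e e.injective _ _ (fun j hj => ?_) fun i => ?_).symm
        · simp only [Function.extend_apply' w _ _ hj, Pi.zero_apply, zero_smul]
        · simp only [e.injective.extend_apply]
    · rintro _ ⟨⟨w, z⟩, ⟨⟨hw, hw1⟩, hz⟩, rfl⟩
      exact (convex_convexHull ℝ s).sum_mem (fun i _ => hw i) hw1
        fun i _ => subset_convexHull ℝ s (hz i (mem_univ i))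
  rw [himage]
  exact ((isCompact_stdSimplex ℝ (Fin n)).prod (isCompact_univ_pi fun _ => hs)).image
    (by fun_prop)

/-- A point of a convex hull at which a linear functional is maximal lies in the convex hull of the
points of the generating set at which the functional takes the same value. -/
lemma mem_convexHull_of_forall_lt {E : Type*} [AddCommGroup E] [Module ℝ E] {f : E →ₗ[ℝ] ℝ}
    {s t : Set E} {z : E} (hs : s.Nonempty) (ht : t.Nonempty) (hz : z ∈ convexHull ℝ (s ∪ t))
    (hfs : ∀ x ∈ s, f x ≤ f z) (hft : ∀ x ∈ t, f x < f z) : z ∈ convexHull ℝ s := by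
  rw [convexHull_union hs ht, mem_convexJoin] at hz
  obtain ⟨u, hu, v, hv, l, m, hl, hm, hlm, rfl⟩ := hz
  have h1 : f u ≤ f (l • u + m • v) :=
    convexHull_min hfs (convex_halfSpace_le f.isLinear _) hu
  have h2 : f v < f (l • u + m • v) :=
    convexHull_min hft (convex_halfSpace_lt f.isLinear _) hv
  have h3 : f (l • u + m • v) = l * f u + m * f v := by simp
  obtain rfl : m = 0 := by
    by_contra hm0
    have : 0 < m := lt_of_le_of_ne hm (Ne.symm hm0)
    have h4 := mul_le_mul_of_nonneg_left h1 hl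
    have h5 := mul_lt_mul_of_pos_left h2 this
    have h6 : (l + m) * f (l • u + m • v) = f (l • u + m • v) := by rw [hlm, one_mul]
    linarith
  obtain rfl : l = 1 := by linarith
  simpa using hu

/-- A set that lies in a closed half-plane has no interior point on the bounding line. -/
lemma notMem_interior_of_inner_nonneg {K : Set ℂ} {z v : ℂ} (hv : v ≠ 0)
    (h : ∀ w ∈ K, 0 ≤ (inner ℝ (w - z) v : ℝ)) : z ∉ interior K := by
  intro hz
  have hc : Filter.Tendsto (fun t : ℝ => z - t • v) (nhdsWithin 0 (Ioi 0)) (nhds z) := by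
    have : Continuous fun t : ℝ => z - t • v := by fun_prop
    exact (this.tendsto' 0 z (by simp)).mono_left nhdsWithin_le_nhds
  obtain ⟨t, ht, ht0⟩ :=
    ((hc.eventually (mem_interior_iff_mem_nhds.1 hz)).and self_mem_nhdsWithin).exists
  have h1 := h _ ht
  have h2 : (inner ℝ (z - t • v - z) v : ℝ) = -(t * ‖v‖ ^ 2) := by
    rw [sub_sub_cancel_left, inner_neg_left, real_inner_smul_left, real_inner_self_eq_norm_sq]
  have h3 : 0 < ‖v‖ := norm_pos_iff.2 hv
  have h4 : 0 < t := ht0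
  rw [h2] at h1
  nlinarith [mul_pos h4 (pow_pos h3 2)]

/-! ### Left-turning arcs, and the convex domain bounded by an arc and its chord. -/

/-- The component of `z` in the direction obtained by rotating the direction `φ` by `π / 2`. -/
def normalComponent (φ : ℝ) (z : ℂ) : ℝ := z.im * Real.cos φ - z.re * Real.sin φ

lemma normalComponent_sub (φ : ℝ) (z w : ℂ) :
    normalComponent φ (z - w) = normalComponent φ z - normalComponent φ w := by
  simp [normalComponent]; ring

lemma normalComponent_add_pi (φ : ℝ) (z : ℂ) :
    normalComponent (φ + Real.pi) z = -normalComponent φ z := by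
  simp [normalComponent, Real.cos_add_pi, Real.sin_add_pi]; ring

lemma normalComponent_sub_pi (φ : ℝ) (z : ℂ) :
    normalComponent (φ - Real.pi) z = -normalComponent φ z := by
  rw [← neg_eq_iff_eq_neg, ← normalComponent_add_pi, sub_add_cancel]

lemma inner_eq_normalComponent (φ : ℝ) (z : ℂ) :
    (inner ℝ z (Complex.I * Complex.exp (φ * Complex.I)) : ℝ) = normalComponent φ z := by
  rw [inner_I_mul_right, Complex.exp_ofReal_mul_I_re, Complex.exp_ofReal_mul_I_im, normalComponent]

/-- `γ` is a plane arc with speed `ρ` and strictly increasing tangent angle `θ`. -/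
structure LeftTurning (a b : ℝ) (γ : ℝ → ℂ) (ρ θ : ℝ → ℝ) : Prop where
  lt : a < b
  continuousOn : ContinuousOn γ (Icc a b)
  hasDerivAt : ∀ p ∈ Ioo a b, HasDerivAt γ (ρ p * Complex.exp (θ p * Complex.I)) p
  speed_pos : ∀ p ∈ Ioo a b, 0 < ρ p
  strictMonoOn : StrictMonoOn θ (Icc a b)

namespace LeftTurning

variable {a b : ℝ} {γ : ℝ → ℂ} {ρ θ : ℝ → ℝ}

/-- The derivative of the component is ρ sin (θ - φ), which is positive while θ lies between φ and φ
+ π. -/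
lemma normalComponent_lt (h : LeftTurning a b γ ρ θ) {φ x y : ℝ} (hx : x ∈ Icc a b)
    (hy : y ∈ Icc a b) (hxy : x < y) (h1 : φ ≤ θ x) (h2 : θ y ≤ φ + Real.pi) :
    normalComponent φ (γ x) < normalComponent φ (γ y) := by
  have hsub : Icc x y ⊆ Icc a b := Icc_subset_Icc hx.1 hy.2
  have hc : ContinuousOn (fun p => normalComponent φ (γ p)) (Icc x y) := by
    have := h.continuousOn.mono hsub
    unfold normalComponent
    exact ((Complex.continuous_im.comp_continuousOn this).mul continuousOn_const).sub
      ((Complex.continuous_re.comp_continuousOn this).mul continuousOn_const)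
  refine strictMonoOn_of_deriv_pos (convex_Icc x y) hc (fun p hp => ?_) (left_mem_Icc.2 hxy.le)
    (right_mem_Icc.2 hxy.le) hxy
  rw [interior_Icc] at hp
  have hp' : p ∈ Ioo a b := ⟨hx.1.trans_lt hp.1, hp.2.trans_le hy.2⟩
  have hd := h.hasDerivAt p hp'
  have hre := Complex.reCLM.hasFDerivAt.comp_hasDerivAt p hd
  have him := Complex.imCLM.hasFDerivAt.comp_hasDerivAt p hd
  have hder : HasDerivAt (fun p => normalComponent φ (γ p)) (ρ p * Real.sin (θ p - φ)) p := by
    refine ((him.mul_const (Real.cos φ)).sub (hre.mul_const (Real.sin φ))).congr_deriv ?_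
    simp only [Complex.reCLM_apply, Complex.imCLM_apply, Complex.re_ofReal_mul,
      Complex.im_ofReal_mul, Complex.exp_ofReal_mul_I_re, Complex.exp_ofReal_mul_I_im, Real.sin_sub]
    ring
  rw [hder.deriv]
  have h3 := h.strictMonoOn hx ⟨hp'.1.le, hp'.2.le⟩ hp.1
  have h4 := h.strictMonoOn ⟨hp'.1.le, hp'.2.le⟩ hy hp.2
  exact mul_pos (h.speed_pos p hp') (Real.sin_pos_of_pos_of_lt_pi (by linarith) (by linarith))

lemma normalComponent_gt (h : LeftTurning a b γ ρ θ) {φ x y : ℝ} (hx : x ∈ Icc a b)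
    (hy : y ∈ Icc a b) (hxy : x < y) (h1 : φ - Real.pi ≤ θ x) (h2 : θ y ≤ φ) :
    normalComponent φ (γ y) < normalComponent φ (γ x) := by
  have := h.normalComponent_lt (φ := φ - Real.pi) hx hy hxy h1 (by linarith)
  rw [normalComponent_sub_pi, normalComponent_sub_pi] at this
  linarith

lemma normalComponent_gt' (h : LeftTurning a b γ ρ θ) {φ x y : ℝ} (hx : x ∈ Icc a b)
    (hy : y ∈ Icc a b) (hxy : x < y) (h1 : φ + Real.pi ≤ θ x) (h2 : θ y ≤ φ + 2 * Real.pi) :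
    normalComponent φ (γ y) < normalComponent φ (γ x) := by
  have := h.normalComponent_lt (φ := φ + Real.pi) hx hy hxy h1 (by linarith)
  rw [normalComponent_add_pi, normalComponent_add_pi] at this
  linarith

/-- A left-turning arc which closes up with its chord to a curve of total turning `2π` with convex
corners. -/
structure ConvexArc (a b : ℝ) (γ : ℝ → ℂ) (ρ θ : ℝ → ℝ) : Prop extends
    LeftTurning a b γ ρ θ where
  pi_le : Real.pi ≤ θ b - θ a
  lt_two_pi : θ b - θ a < 2 * Real.pi
  left_pos : 0 < normalComponent (θ a) (γ b - γ a)
  right_neg : normalComponent (θ b) (γ b - γ a) < 0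

namespace ConvexArc

variable (h : ConvexArc a b γ ρ θ)
include h

lemma left_mem : a ∈ Icc a b := left_mem_Icc.2 h.lt.le

lemma right_mem : b ∈ Icc a b := right_mem_Icc.2 h.lt.le

lemma le_angle {p : ℝ} (hp : p ∈ Icc a b) : θ a ≤ θ p :=
  h.strictMonoOn.monotoneOn h.left_mem hp hp.1

lemma angle_le {p : ℝ} (hp : p ∈ Icc a b) : θ p ≤ θ b :=
  h.strictMonoOn.monotoneOn hp h.right_mem hp.2

/-- The direction φ lies between θ a and θ b - π, which are less than π apart. Its component is
therefore a nonnegative combination, with sine coefficients, of the two end components, both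
positive by the corner conditions. -/
lemma chord_pos {φ : ℝ} (h1 : θ a ≤ φ) (h2 : φ ≤ θ b - Real.pi) :
    0 < normalComponent φ (γ b - γ a) := by
  have hl := h.left_pos
  have hr := h.right_neg
  have hlt := h.lt_two_pi
  rcases eq_or_lt_of_le h1 with rfl | h1'
  · exact hl
  set D := γ b - γ a
  have hr' : 0 < normalComponent (θ b - Real.pi) D := by
    rw [normalComponent_sub_pi]; linarith
  set ψ := θ b - Real.pi with hψ
  have key : Real.sin (ψ - θ a) * normalComponent φ D =
      Real.sin (ψ - φ) * normalComponent (θ a) D + Real.sin (φ - θ a) * normalComponent ψ D := by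
    simp only [normalComponent, Real.sin_sub]
    have e1 := Real.sin_sq_add_cos_sq φ
    have e2 := Real.sin_sq_add_cos_sq ψ
    have e3 := Real.sin_sq_add_cos_sq (θ a)
    ring
  have s1 : 0 < Real.sin (ψ - θ a) :=
    Real.sin_pos_of_pos_of_lt_pi (by linarith) (by linarith)
  have s2 : 0 ≤ Real.sin (ψ - φ) :=
    Real.sin_nonneg_of_nonneg_of_le_pi (by linarith) (by linarith)
  have s3 : 0 < Real.sin (φ - θ a) :=
    Real.sin_pos_of_pos_of_lt_pi (by linarith) (by linarith)
  refine pos_of_mul_pos_right (a := Real.sin (ψ - θ a)) ?_ s1.le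
  rw [key]
  have := mul_nonneg s2 hl.le
  have := mul_pos s3 hr'
  linarith

/-- The arc lies strictly to the left of each of its tangent lines. -/
theorem normalComponent_pos {p q : ℝ} (hp : p ∈ Icc a b) (hq : q ∈ Icc a b) (hpq : p ≠ q) :
    0 < normalComponent (θ p) (γ q - γ p) := by
  have hL := h.toLeftTurning
  have h2 := h.lt_two_pi
  have ha {x : ℝ} (hx : x ∈ Icc a b) := h.le_angle hx
  have hb {x : ℝ} (hx : x ∈ Icc a b) := h.angle_le hx
  rcases lt_or_gt_of_ne hpq with hlt | hlt
  · by_cases hθ : θ q ≤ θ p + Real.pi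
    · have := hL.normalComponent_lt hp hq hlt le_rfl hθ
      rw [normalComponent_sub]; linarith
    -- The arc turns by more than π from p to q, so the comparison runs the other way round: from q
    -- forward to b, along the chord to a, and forward again to p, with the component nonincreasing
    -- on the arcs and decreasing on the chord.
    · push Not at hθ
      have hbq := hb hq
      have h3 : normalComponent (θ p) (γ b) ≤ normalComponent (θ p) (γ q) := by
        rcases eq_or_lt_of_le hq.2 with rfl | hqb
        · exact le_rfl
        · exact (hL.normalComponent_gt' hq h.right_mem hqb hθ.le (by linarith [ha hp])).le
      have h4 : normalComponent (θ p) (γ p) ≤ normalComponent (θ p) (γ a) := by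
        rcases eq_or_lt_of_le hp.1 with rfl | hap
        · exact le_rfl
        · exact (hL.normalComponent_gt h.left_mem hp hap (by linarith) le_rfl).le
      have h5 := h.chord_pos (ha hp) (by linarith)
      rw [normalComponent_sub] at h5 ⊢
      linarith
  · by_cases hθ : θ p - Real.pi ≤ θ q
    · have := hL.normalComponent_gt hq hp hlt hθ le_rfl
      rw [normalComponent_sub]; linarith
    · push Not at hθ
      have haq := ha hq
      have h3 : normalComponent (θ p) (γ a) ≤ normalComponent (θ p) (γ q) := by
        rcases eq_or_lt_of_le hq.1 with rfl | haq'
        · exact le_rfl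
        · have := (hL.normalComponent_lt (φ := θ p - 2 * Real.pi) h.left_mem hq haq'
            (by linarith [hb hp]) (by linarith)).le
          simpa [normalComponent, Real.cos_sub_two_pi, Real.sin_sub_two_pi] using this
      have h4 : normalComponent (θ p) (γ p) ≤ normalComponent (θ p) (γ b) := by
        rcases eq_or_lt_of_le hp.2 with rfl | hpb
        · exact le_rfl
        · exact (hL.normalComponent_lt hp h.right_mem hpb le_rfl (by linarith)).le
      have h5 := h.chord_pos (φ := θ p - Real.pi) (by linarith) (by linarith [hb hp])
      rw [normalComponent_sub_pi, normalComponent_sub] at h5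
      rw [normalComponent_sub]
      linarith

lemma injOn : InjOn γ (Icc a b) := by
  intro p hp q hq hpq
  by_contra hne
  have := h.normalComponent_pos hp hq hne
  rw [hpq] at this
  simp [normalComponent] at this

lemma ne : γ a ≠ γ b := fun hab => h.lt.ne (h.injOn h.left_mem h.right_mem hab)

/-- The arc lies strictly to the right of its chord. -/
lemma exists_chord_angle : ∃ δ, normalComponent δ (γ b) = normalComponent δ (γ a) ∧
    ∀ q ∈ Ioo a b, normalComponent δ (γ q) < normalComponent δ (γ a) := by
  have hlt := h.lt_two_pi
  have hpi := h.pi_le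
  -- The chord turned back by θ a lies in the open upper half-plane, so its argument is in (0, π)
  -- and δ is the tangent angle parallel to the chord.
  set w : ℂ := (γ b - γ a) * Complex.exp ((-θ a : ℝ) * Complex.I) with hw
  have hwim : w.im = normalComponent (θ a) (γ b - γ a) := by
    rw [hw, Complex.mul_im, Complex.exp_ofReal_mul_I_re, Complex.exp_ofReal_mul_I_im,
      Real.cos_neg, Real.sin_neg, normalComponent]
    ring
  have hl := h.left_pos
  rw [← hwim] at hl
  set δ := θ a + w.arg with hδ
  have harg0 : 0 < w.arg := by
    refine lt_of_le_of_ne (Complex.arg_nonneg_iff.2 hl.le) fun h0 => ?_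
    have := (Complex.arg_eq_zero_iff.1 h0.symm).2
    linarith
  have hargpi : w.arg < Real.pi := by
    refine lt_of_le_of_ne (Complex.arg_le_pi w) fun h0 => ?_
    have := (Complex.arg_eq_pi_iff.1 h0).2
    linarith
  have hD : γ b - γ a = ‖w‖ * Complex.exp (δ * Complex.I) := by
    have h1 : (γ b - γ a) = w * Complex.exp (θ a * Complex.I) := by
      rw [hw, mul_assoc, ← Complex.exp_add]
      simp
    rw [h1]
    conv_lhs => rw [← Complex.norm_mul_exp_arg_mul_I w]
    rw [mul_assoc, ← Complex.exp_add, hδ]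
    congr 2
    push_cast
    ring
  have hcomp : ∀ φ, normalComponent φ (γ b - γ a) = ‖w‖ * Real.sin (δ - φ) := by
    intro φ
    rw [hD, normalComponent, Complex.re_ofReal_mul, Complex.im_ofReal_mul,
      Complex.exp_ofReal_mul_I_re, Complex.exp_ofReal_mul_I_im, Real.sin_sub]
    ring
  have hw0 : 0 < ‖w‖ := norm_pos_iff.2 fun h0 => by simp [h0] at hl
  have hend : θ b < δ + Real.pi := by
    by_contra! hge
    have h1 := h.right_neg
    rw [hcomp] at h1
    have h2 : 0 ≤ Real.sin (δ - θ b) := by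
      rw [← Real.sin_add_two_pi]
      exact Real.sin_nonneg_of_nonneg_of_le_pi (by linarith) (by linarith)
    nlinarith
  have heq : normalComponent δ (γ b) = normalComponent δ (γ a) := by
    have := hcomp δ
    rw [normalComponent_sub] at this
    simp at this
    linarith
  refine ⟨δ, heq, fun q hq => ?_⟩
  have hq' : q ∈ Icc a b := ⟨hq.1.le, hq.2.le⟩
  rcases le_total (θ q) δ with hθ | hθ
  · exact h.toLeftTurning.normalComponent_gt h.left_mem hq' hq.1 (by linarith) hθ
  · rw [← heq]
    exact h.toLeftTurning.normalComponent_lt hq' h.right_mem hq.2 hθ hend.le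

/-- If γ q is not an end point, both end points lie strictly to the left of the tangent line at q,
and so does their whole segment. -/
lemma image_inter_segment : γ '' Icc a b ∩ segment ℝ (γ b) (γ a) = {γ a, γ b} := by
  apply Subset.antisymm
  · rintro _ ⟨⟨q, hq, rfl⟩, l, m, hl, hm, hlm, hz⟩
    by_contra hne
    simp only [mem_insert_iff, mem_singleton_iff, not_or] at hne
    have h1 := h.normalComponent_pos hq h.left_mem fun h0 => hne.1 (by rw [h0])
    have h2 := h.normalComponent_pos hq h.right_mem fun h0 => hne.2 (by rw [h0])
    have h3 : normalComponent (θ q) (γ q) =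
        l * normalComponent (θ q) (γ b) + m * normalComponent (θ q) (γ a) := by
      conv_lhs => rw [← hz]
      simp [normalComponent]; ring
    rw [normalComponent_sub] at h1 h2
    obtain rfl : m = 1 - l := by linarith
    rcases eq_or_lt_of_le hl with rfl | hl0
    · simp at h3; linarith
    · nlinarith [mul_pos hl0 h2, mul_nonneg hm h1.le]
  · rintro z (rfl | rfl)
    · exact ⟨mem_image_of_mem _ h.left_mem, right_mem_segment ..⟩
    · exact ⟨mem_image_of_mem _ h.right_mem, left_mem_segment ..⟩

/-- As the open arc lies off the line of the chord, any of its points spans a proper triangle with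
the two end points. -/
lemma interior_convexHull_nonempty : (interior (convexHull ℝ (γ '' Icc a b))).Nonempty := by
  obtain ⟨δ, h1, h2⟩ := h.exists_chord_angle
  obtain ⟨m, hm⟩ : (Ioo a b).Nonempty := nonempty_Ioo.2 h.lt
  have h3 := h2 m hm
  have hsub : ({γ a, γ b, γ m} : Set ℂ) ⊆ γ '' Icc a b := by
    rintro z (rfl | rfl | rfl)
    exacts [mem_image_of_mem _ h.left_mem, mem_image_of_mem _ h.right_mem,
      mem_image_of_mem _ ⟨hm.1.le, hm.2.le⟩]
  have hnc : ¬ Collinear ℝ ({γ a, γ b, γ m} : Set ℂ) := by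
    rw [collinear_iff_of_mem (p₀ := γ a) (by simp)]
    rintro ⟨v, hv⟩
    obtain ⟨r, hr⟩ := hv (γ b) (by simp)
    obtain ⟨r', hr'⟩ := hv (γ m) (by simp)
    have hlin : ∀ t : ℝ, normalComponent δ (t • v +ᵥ γ a) =
        t * normalComponent δ v + normalComponent δ (γ a) := by
      intro t; simp [normalComponent]; ring
    rw [hr, hlin] at h1
    rw [hr', hlin] at h3
    have : r * normalComponent δ v = 0 := by linarith
    rcases mul_eq_zero.1 this with h0 | h0
    · rw [h0] at hr
      exact h.ne (by simpa using hr.symm)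
    · rw [h0] at h3; simp at h3
  have hind := affineIndependent_iff_not_collinear_set.2 hnc
  have htop := hind.affineSpan_eq_top_iff_card_eq_finrank_add_one.2
    (by simp [Complex.finrank_real_complex])
  have hne := interior_convexHull_nonempty_iff_affineSpan_eq_top.2 htop
  refine hne.mono (interior_mono (convexHull_mono ?_))
  rintro _ ⟨i, rfl⟩
  fin_cases i
  exacts [hsub (by simp), hsub (by simp), hsub (by simp)]

/-- The tangent lines and the line of the chord are supporting lines of the hull. -/
lemma notMem_interior_convexHull {z : ℂ} (hz : z ∈ γ '' Icc a b ∪ segment ℝ (γ b) (γ a)) :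
    z ∉ interior (convexHull ℝ (γ '' Icc a b)) := by
  have key : ∀ φ : ℝ, (∀ q ∈ Icc a b, normalComponent φ z ≤ normalComponent φ (γ q)) →
      z ∉ interior (convexHull ℝ (γ '' Icc a b)) := by
    intro φ hφ
    refine notMem_interior_of_inner_nonneg
      (v := Complex.I * Complex.exp (φ * Complex.I)) (by simp) fun w hw => ?_
    rw [inner_eq_normalComponent, normalComponent_sub, sub_nonneg]
    have hlin : IsLinearMap ℝ (normalComponent φ) :=
      ⟨fun x y => by simp [normalComponent]; ring, fun c x => by simp [normalComponent]; ring⟩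
    refine convexHull_min (s := γ '' Icc a b) ?_ (convex_halfSpace_ge hlin _) hw
    rintro _ ⟨q, hq, rfl⟩
    exact hφ q hq
  rcases hz with ⟨p, hp, rfl⟩ | ⟨l, m, hl, hm, hlm, rfl⟩
  · refine key (θ p) fun q hq => ?_
    rcases eq_or_ne p q with rfl | hne
    · exact le_rfl
    · have := h.normalComponent_pos hp hq hne
      rw [normalComponent_sub] at this
      linarith
  · obtain ⟨δ, h1, h2⟩ := h.exists_chord_angle
    refine key (δ + Real.pi) fun q hq => ?_
    have h3 : normalComponent δ (l • γ b + m • γ a) = normalComponent δ (γ a) := by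
      have : normalComponent δ (l • γ b + m • γ a) =
          l * normalComponent δ (γ b) + m * normalComponent δ (γ a) := by
        simp [normalComponent]; ring
      rw [this, h1, ← add_mul, hlm, one_mul]
    rw [normalComponent_add_pi, normalComponent_add_pi, h3]
    rcases eq_or_lt_of_le hq.1 with rfl | ha
    · exact le_rfl
    rcases eq_or_lt_of_le hq.2 with rfl | hb
    · rw [h1]
    · linarith [h2 q ⟨ha, hb⟩]

/-- A supporting functional at z is maximal on a face of the hull. If the face touches the open arc
at γ q, the functional is a multiple of the normal component at q, and strict tangency leaves only
the point γ q. Otherwise the face is spanned by the end points and lies on the chord. -/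
lemma mem_of_notMem_interior_convexHull {z : ℂ} (hz : z ∈ convexHull ℝ (γ '' Icc a b))
    (hzi : z ∉ interior (convexHull ℝ (γ '' Icc a b))) :
    z ∈ γ '' Icc a b ∪ segment ℝ (γ b) (γ a) := by
  set K := convexHull ℝ (γ '' Icc a b) with hK
  have hconv : Convex ℝ K := convex_convexHull ℝ _
  have hne := h.interior_convexHull_nonempty
  obtain ⟨f, hf⟩ := geometric_hahn_banach_open_point hconv.interior isOpen_interior hzi
  have hle : ∀ w ∈ K, f w ≤ f z := by
    intro w hw
    have h1 : w ∈ closure (interior K) := by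
      rw [hconv.closure_interior_eq_closure_of_nonempty_interior hne]
      exact subset_closure hw
    exact closure_minimal (fun x hx => (hf x hx).le)
      (isClosed_le f.continuous continuous_const) h1
  have hmem : ∀ q ∈ Icc a b, γ q ∈ K := fun q hq => subset_convexHull ℝ _ (mem_image_of_mem _ hq)
  have hfre : ∀ w : ℂ, f w = w.re * f 1 + w.im * f Complex.I := by
    intro w
    conv_lhs => rw [← Complex.re_add_im w, mul_comm, map_add]
    have h1 : (w.re : ℂ) = w.re • (1 : ℂ) := by simp
    have h2 : Complex.I * (w.im : ℂ) = w.im • Complex.I := by simp [mul_comm]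
    rw [h1, h2, map_smul, map_smul]; simp
  by_cases hq : ∃ q ∈ Ioo a b, f (γ q) = f z
  · obtain ⟨q, hq, hqz⟩ := hq
    have hq' : q ∈ Icc a b := ⟨hq.1.le, hq.2.le⟩
    left
    have hder : HasDerivAt (fun p => f (γ p)) (f (ρ q * Complex.exp (θ q * Complex.I))) q :=
      f.hasFDerivAt.comp_hasDerivAt q (h.hasDerivAt q hq)
    have hmax : IsLocalMax (fun p => f (γ p)) q := by
      filter_upwards [Icc_mem_nhds hq.1 hq.2] with p hp
      rw [hqz]
      exact hle _ (hmem p hp)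
    have h0 := hmax.hasDerivAt_eq_zero hder
    rw [hfre, Complex.re_ofReal_mul, Complex.im_ofReal_mul, Complex.exp_ofReal_mul_I_re,
      Complex.exp_ofReal_mul_I_im] at h0
    have hρ := h.speed_pos q hq
    have h0' : Real.cos (θ q) * f 1 + Real.sin (θ q) * f Complex.I = 0 := by
      refine (mul_eq_zero.1 (?_ : ρ q * _ = 0)).resolve_left hρ.ne'
      linear_combination h0
    set μ := f Complex.I * Real.cos (θ q) - f 1 * Real.sin (θ q) with hμ
    have hfμ : ∀ w, f w = μ * normalComponent (θ q) w := by
      intro w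
      rw [hfre w, hμ, normalComponent]
      have := Real.sin_sq_add_cos_sq (θ q)
      linear_combination (-(w.re * f 1 + w.im * f Complex.I)) * this +
        (w.re * Real.cos (θ q) + w.im * Real.sin (θ q)) * h0'
    have hμ0 : μ ≠ 0 := by
      intro h00
      obtain ⟨x, hx⟩ := hne
      have := hf x hx
      rw [hfμ, hfμ z, h00] at this
      simp at this
    have hlt : ∀ p ∈ Icc a b, p ≠ q → f (γ p) < f z := by
      intro p hp hpq
      refine lt_of_le_of_ne (hle _ (hmem p hp)) fun h1 => ?_
      have h2 := h.normalComponent_pos hq' hp (Ne.symm hpq)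
      rw [normalComponent_sub] at h2
      rw [← hqz, hfμ, hfμ (γ q)] at h1
      have := mul_left_cancel₀ hμ0 h1
      linarith
    have hunion : γ '' Icc a b = {γ q} ∪ γ '' (Icc a b \ {q}) := by
      rw [← image_singleton, ← image_union, union_sdiff_cancel (singleton_subset_iff.2 hq')]
    rw [hK, hunion] at hz
    have := mem_convexHull_of_forall_lt (f := f.toLinearMap) (singleton_nonempty _)
      ⟨γ a, mem_image_of_mem γ (show a ∈ Icc a b \ {q} from ⟨h.left_mem, hq.1.ne⟩)⟩ hz
      (by rintro x rfl; exact hqz.le)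
      (by rintro _ ⟨p, ⟨hp, hpq⟩, rfl⟩; exact hlt p hp hpq)
    rw [convexHull_singleton] at this
    exact ⟨q, hq', this.symm⟩
  · push Not at hq
    right
    have hunion : γ '' Icc a b = {γ b, γ a} ∪ γ '' Ioo a b := by
      rw [← image_pair, ← image_union]
      congr 1
      rw [pair_comm, union_comm, Ioo_union_both h.lt.le]
    rw [hK, hunion] at hz
    have := mem_convexHull_of_forall_lt (f := f.toLinearMap) ⟨γ b, by simp⟩
      ((nonempty_Ioo.2 h.lt).image γ) hz
      (by rintro x (rfl | rfl)
          exacts [hle _ (hmem _ h.right_mem), hle _ (hmem _ h.left_mem)])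
      (by rintro _ ⟨p, hp, rfl⟩
          exact lt_of_le_of_ne (hle _ (hmem p ⟨hp.1.le, hp.2.le⟩)) (hq p hp))
    rwa [convexHull_pair] at this

theorem boundsConvexDomain : BoundsConvexDomain a b γ := by
  have hcomp : IsCompact (convexHull ℝ (γ '' Icc a b)) :=
    isCompact_convexHull_of_isCompact (isCompact_Icc.image_of_continuousOn h.continuousOn)
  have hconv : Convex ℝ (convexHull ℝ (γ '' Icc a b)) := convex_convexHull ℝ _
  have hne := h.interior_convexHull_nonempty
  refine ⟨h.ne, h.image_inter_segment, interior (convexHull ℝ (γ '' Icc a b)), isOpen_interior,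
    hne, hcomp.isBounded.subset interior_subset, hconv.interior, ?_⟩
  rw [frontier, interior_interior, hconv.closure_interior_eq_closure_of_nonempty_interior hne,
    hcomp.isClosed.closure_eq]
  apply Subset.antisymm
  · rintro z ⟨h1, h2⟩
    exact h.mem_of_notMem_interior_convexHull h1 h2
  · intro z hz
    refine ⟨?_, h.notMem_interior_convexHull hz⟩
    rcases hz with hz | hz
    · exact subset_convexHull ℝ _ hz
    · exact hconv.segment_subset
        (subset_convexHull ℝ _ (mem_image_of_mem _ h.right_mem))
        (subset_convexHull ℝ _ (mem_image_of_mem _ h.left_mem)) hz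

end ConvexArc
end LeftTurning

/-! ### Derivatives of the length and the direction of a plane vector field. -/

lemma complex_eq_of_norm_one {u : ℂ} (hu : ‖u‖ = 1) (w : ℂ) :
    w = (inner ℝ w u : ℝ) • u + (inner ℝ w (Complex.I * u) : ℝ) • (Complex.I * u) := by
  have h : u.re ^ 2 + u.im ^ 2 = 1 := by
    rw [Complex.norm_eq_sqrt_sq_add_sq, Real.sqrt_eq_one] at hu
    exact hu
  apply Complex.ext
  · simp [↓inner_I_mul_right]
    linear_combination (-w.re) * h
  · simp [↓inner_I_mul_right]
    linear_combination (-w.im) * h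

lemma norm_unit {w : ℂ} (h : w ≠ 0) : ‖(‖w‖⁻¹ : ℝ) • w‖ = 1 := by
  rw [norm_smul, norm_inv, norm_norm, inv_mul_cancel₀ (norm_ne_zero_iff.2 h)]

/-- The derivative of the norm of a nonvanishing plane vector field along a line. -/
lemma hasDerivWithinAt_norm {w : ℝ → ℂ} {w' : ℂ} {s : Set ℝ} {x : ℝ}
    (hw : HasDerivWithinAt w w' s x) (h0 : w x ≠ 0) :
    HasDerivWithinAt (fun y => ‖w y‖) (inner ℝ w' ((‖w x‖⁻¹ : ℝ) • w x)) s x := by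
  have hn : ‖w x‖ ≠ 0 := norm_ne_zero_iff.2 h0
  have h1 := hw.norm_sq.sqrt (pow_ne_zero 2 hn)
  simp only [Real.sqrt_sq (norm_nonneg _)] at h1
  refine h1.congr_deriv ?_
  rw [real_inner_smul_right, real_inner_comm]
  field_simp

/-- The derivative of the direction of a nonvanishing plane vector field along a line. -/
lemma hasDerivWithinAt_unit {w : ℝ → ℂ} {w' : ℂ} {s : Set ℝ} {x : ℝ}
    (hw : HasDerivWithinAt w w' s x) (h0 : w x ≠ 0) :
    HasDerivWithinAt (fun y => (‖w y‖⁻¹ : ℝ) • w y)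
      ((inner ℝ w' (Complex.I * ((‖w x‖⁻¹ : ℝ) • w x)) / ‖w x‖) •
        (Complex.I * ((‖w x‖⁻¹ : ℝ) • w x))) s x := by
  have hn : ‖w x‖ ≠ 0 := norm_ne_zero_iff.2 h0
  refine (((hasDerivWithinAt_norm hw h0).inv hn).smul hw).congr_deriv ?_
  set u := (‖w x‖⁻¹ : ℝ) • w x with hu
  have hwu : w x = ‖w x‖ • u := by rw [hu, smul_smul, mul_inv_cancel₀ hn, one_smul]
  have h1 := complex_eq_of_norm_one (norm_unit h0) w'
  rw [← hu] at h1
  set A : ℝ := inner ℝ w' u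
  set B : ℝ := inner ℝ w' (Complex.I * u)
  have e : ∀ r : ℝ, r • w x = (r * ‖w x‖) • u := fun r => by rw [mul_smul, ← hwu]
  change ‖w x‖⁻¹ • w' + (-A / ‖w x‖ ^ 2) • w x = _
  rw [h1, e]
  match_scalars <;> field_simp
  ring

/-! ### Tangent angle, total curvature and length of a plane curve. -/

namespace PlaneCurve

variable {a b : ℝ} {γ : ℝ → ℂ}

lemma hasDerivWithinAt_velocity (hγ : ContDiffOn ℝ ∞ γ (Icc a b)) {p : ℝ} (hp : p ∈ Icc a b) :
    HasDerivWithinAt γ (velocity a b γ p) (Icc a b) p :=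
  (hγ.differentiableOn (by simp) p hp).hasDerivWithinAt

lemma contDiffOn_velocity (hab : a < b) (hγ : ContDiffOn ℝ ∞ γ (Icc a b)) :
    ContDiffOn ℝ ∞ (velocity a b γ) (Icc a b) :=
  hγ.derivWithin (uniqueDiffOn_Icc hab) (by simp)

lemma hasDerivWithinAt_acceleration (hab : a < b) (hγ : ContDiffOn ℝ ∞ γ (Icc a b)) {p : ℝ}
    (hp : p ∈ Icc a b) :
    HasDerivWithinAt (velocity a b γ) (acceleration a b γ p) (Icc a b) p :=
  hasDerivWithinAt_velocity (contDiffOn_velocity hab hγ) hp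

lemma norm_tangent {p : ℝ} (h : velocity a b γ p ≠ 0) : ‖tangent a b γ p‖ = 1 := norm_unit h

lemma velocity_eq_smul_tangent {p : ℝ} (h : velocity a b γ p ≠ 0) :
    velocity a b γ p = ‖velocity a b γ p‖ • tangent a b γ p := by
  rw [tangent, smul_smul, mul_inv_cancel₀ (norm_ne_zero_iff.2 h), one_smul]

lemma hasDerivWithinAt_tangent (hab : a < b) (hγ : ContDiffOn ℝ ∞ γ (Icc a b))
    (hr : Regular a b γ) {p : ℝ} (hp : p ∈ Icc a b) :
    HasDerivWithinAt (tangent a b γ)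
      ((curvature a b γ p * ‖velocity a b γ p‖) • normal a b γ p) (Icc a b) p := by
  refine (hasDerivWithinAt_unit (hasDerivWithinAt_acceleration hab hγ hp) (hr p hp)).congr_deriv ?_
  have hn : ‖velocity a b γ p‖ ≠ 0 := norm_ne_zero_iff.2 (hr p hp)
  change (inner ℝ (acceleration a b γ p) (normal a b γ p) / ‖velocity a b γ p‖) •
    normal a b γ p = _
  congr 1
  rw [curvature]
  field_simp

lemma continuousOn_curvature_mul (hab : a < b) (hγ : ContDiffOn ℝ ∞ γ (Icc a b))
    (hr : Regular a b γ) :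
    ContinuousOn (fun p => curvature a b γ p * ‖velocity a b γ p‖) (Icc a b) := by
  have h1 := (contDiffOn_velocity hab hγ).continuousOn
  have h2 : ContinuousOn (acceleration a b γ) (Icc a b) :=
    (contDiffOn_velocity hab (contDiffOn_velocity hab hγ)).continuousOn
  have h3 : ContinuousOn (tangent a b γ) (Icc a b) := fun p hp =>
    (hasDerivWithinAt_tangent hab hγ hr hp).continuousWithinAt
  have h4 : ∀ p ∈ Icc a b, ‖velocity a b γ p‖ ≠ 0 := fun p hp => norm_ne_zero_iff.2 (hr p hp)
  unfold curvature normal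
  exact ((h2.inner (continuousOn_const.mul h3)).div (h1.norm.pow 2)
    fun p hp => pow_ne_zero 2 (h4 p hp)).mul h1.norm

/-- The total curvature of a plane curve. -/
def totalCurvature (a b : ℝ) (γ : ℝ → ℂ) : ℝ :=
  ∫ p in a..b, curvature a b γ p * ‖velocity a b γ p‖

/-- A regular plane curve has a differentiable tangent angle, the derivative of which with respect
to the arclength is the curvature. -/
theorem exists_tangent_angle (hab : a < b) (hγ : ContDiffOn ℝ ∞ γ (Icc a b))
    (hr : Regular a b γ) : ∃ θ : ℝ → ℝ, Continuous θ ∧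
      (∀ p ∈ Icc a b, HasDerivAt θ (curvature a b γ p * ‖velocity a b γ p‖) p) ∧
      (∀ p ∈ Icc a b, tangent a b γ p = Complex.exp (θ p * Complex.I)) ∧
      θ b - θ a = totalCurvature a b γ := by
  set K : ℝ → ℝ := fun p => curvature a b γ p * ‖velocity a b γ p‖
  -- Clamping the parameter extends the integrand continuously to ℝ, so θ has two-sided derivatives
  -- also at a and b.
  set K' : ℝ → ℝ := fun p => K (projIcc a b hab.le p) with hK'
  have hKc : Continuous K' := (continuousOn_curvature_mul hab hγ hr).comp_continuous
    (continuous_subtype_val.comp continuous_projIcc) fun p => (projIcc a b hab.le p).2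
  have hKK : ∀ p ∈ Icc a b, K' p = K p := fun p hp => by
    simp only [hK', projIcc_of_mem hab.le hp]
  set θ : ℝ → ℝ := fun p => (tangent a b γ a).arg + ∫ x in a..p, K' x with hθ
  have hd : ∀ p, HasDerivAt θ (K' p) p := fun p =>
    ((hKc.integral_hasStrictDerivAt a p).hasDerivAt).const_add _
  have hda : ∀ p ∈ Icc a b, HasDerivAt θ (K p) p := fun p hp => hKK p hp ▸ hd p
  refine ⟨θ, continuous_iff_continuousAt.2 fun p => (hd p).continuousAt, hda, ?_, ?_⟩
  -- Both factors turn at the same rate, so the product is constant; it equals 1 at a because θ a is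
  -- the argument of the initial tangent.
  · have hconst : ∀ p ∈ Icc a b, HasDerivWithinAt
        (fun p => Complex.exp (-(θ p * Complex.I)) * tangent a b γ p) 0 (Icc a b) p := by
      intro p hp
      have h1 : HasDerivWithinAt (fun p => (θ p : ℂ)) (K p : ℂ) (Icc a b) p :=
        ((hda p hp).ofReal_comp).hasDerivWithinAt
      refine (((h1.mul_const Complex.I).neg.cexp).mul
        (hasDerivWithinAt_tangent hab hγ hr hp)).congr_deriv ?_
      rw [normal, Complex.real_smul]
      ring
    have ha : a ∈ Icc a b := left_mem_Icc.2 hab.le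
    intro p hp
    have h2 := (convex_Icc a b).norm_image_sub_le_of_norm_hasDerivWithin_le (C := 0) hconst
      (fun x _ => by simp) ha hp
    rw [zero_mul, norm_le_zero_iff, sub_eq_zero] at h2
    have h3 : Complex.exp (-(θ a * Complex.I)) * tangent a b γ a = 1 := by
      have : tangent a b γ a = Complex.exp (θ a * Complex.I) := by
        have h4 := Complex.norm_mul_exp_arg_mul_I (tangent a b γ a)
        rw [norm_tangent (hr a ha)] at h4
        simp only [hθ, intervalIntegral.integral_same, add_zero]
        simpa using h4.symm
      rw [this, ← Complex.exp_add]
      simp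
    rw [h3, Complex.exp_neg] at h2
    field_simp at h2
    exact h2
  · simp only [hθ, intervalIntegral.integral_same, add_zero, add_sub_cancel_left, totalCurvature]
    refine intervalIntegral.integral_congr fun p hp => ?_
    rw [uIcc_of_le hab.le] at hp
    exact hKK p hp

/-- The velocity extended by constants to the real line. -/
def velocityExtend (a b : ℝ) (hab : a ≤ b) (γ : ℝ → ℂ) (p : ℝ) : ℂ :=
  velocity a b γ (projIcc a b hab p)

lemma continuous_velocityExtend (hab : a < b) (hγ : ContDiffOn ℝ ∞ γ (Icc a b)) :
    Continuous (velocityExtend a b hab.le γ) :=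
  (contDiffOn_velocity hab hγ).continuousOn.comp_continuous
    (continuous_subtype_val.comp continuous_projIcc) fun p => (projIcc a b hab.le p).2

lemma hasDerivAt_of_mem_Ioo (hγ : ContDiffOn ℝ ∞ γ (Icc a b)) {p : ℝ} (hp : p ∈ Ioo a b) :
    HasDerivAt γ (velocity a b γ p) p :=
  (hasDerivWithinAt_velocity hγ ⟨hp.1.le, hp.2.le⟩).hasDerivAt (Icc_mem_nhds hp.1 hp.2)

lemma integral_velocity (hab : a < b) (hγ : ContDiffOn ℝ ∞ γ (Icc a b)) {p q : ℝ}
    (hp : p ∈ Icc a b) (hq : q ∈ Icc a b) :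
    ∫ x in p..q, velocityExtend a b hab.le γ x = γ q - γ p := by
  have key : ∀ q ∈ Icc a b, ∫ x in a..q, velocityExtend a b hab.le γ x = γ q - γ a := by
    intro q hq
    refine intervalIntegral.integral_eq_sub_of_hasDerivAt_of_le hq.1
      (hγ.continuousOn.mono (Icc_subset_Icc_right hq.2)) (fun x hx => ?_)
      ((continuous_velocityExtend hab hγ).intervalIntegrable _ _)
    have hx' : x ∈ Ioo a b := ⟨hx.1, hx.2.trans_le hq.2⟩
    rw [velocityExtend, projIcc_of_mem hab.le ⟨hx'.1.le, hx'.2.le⟩]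
    exact hasDerivAt_of_mem_Ioo hγ hx'
  have hi := fun x y =>
    (continuous_velocityExtend hab hγ).intervalIntegrable (μ := MeasureTheory.volume) x y
  rw [← intervalIntegral.integral_interval_sub_left (hi a q) (hi a p), key q hq, key p hp]
  abel

lemma norm_sub_le_length (hab : a < b) (hγ : ContDiffOn ℝ ∞ γ (Icc a b)) {p q : ℝ}
    (hp : p ∈ Icc a b) (hq : q ∈ Icc a b) : ‖γ q - γ p‖ ≤ length a b γ := by
  wlog hpq : p ≤ q generalizing p q
  · rw [norm_sub_rev]
    exact this hq hp (le_of_not_ge hpq)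
  rw [← integral_velocity hab hγ hp hq]
  have hc := (continuous_velocityExtend hab hγ).norm
  refine (intervalIntegral.norm_integral_le_integral_norm hpq).trans ?_
  have h1 : length a b γ = ∫ x in a..b, ‖velocityExtend a b hab.le γ x‖ := by
    refine intervalIntegral.integral_congr fun x hx => ?_
    rw [uIcc_of_le hab.le] at hx
    simp only [velocityExtend, projIcc_of_mem hab.le hx]
  rw [h1]
  exact intervalIntegral.integral_mono_interval hp.1 hpq hq.2
    (Filter.Eventually.of_forall fun x => norm_nonneg _) (hc.intervalIntegrable _ _)

/-! ### Hopf's secant argument for the total curvature of an embedded curve. -/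

/-- The difference quotient of a curve, continuously extended to the diagonal by the velocity. -/
def diffQuot (a b : ℝ) (hab : a ≤ b) (γ : ℝ → ℂ) (x : ℝ × ℝ) : ℂ :=
  ∫ σ in (0 : ℝ)..1, velocityExtend a b hab γ (x.1 + (x.2 - x.1) * σ)

lemma continuous_diffQuot (hab : a < b) (hγ : ContDiffOn ℝ ∞ γ (Icc a b)) :
    Continuous (diffQuot a b hab.le γ) := by
  refine intervalIntegral.continuous_parametric_intervalIntegral_of_continuous'
    (f := fun (x : ℝ × ℝ) σ => velocityExtend a b hab.le γ (x.1 + (x.2 - x.1) * σ)) ?_ 0 1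
  have := continuous_velocityExtend hab hγ
  unfold Function.uncurry
  fun_prop

lemma diffQuot_self (hab : a < b) {p : ℝ} (hp : p ∈ Icc a b) :
    diffQuot a b hab.le γ (p, p) = velocity a b γ p := by
  simp [diffQuot, velocityExtend, projIcc_of_mem hab.le hp]

lemma sub_smul_diffQuot (hab : a < b) (hγ : ContDiffOn ℝ ∞ γ (Icc a b)) {p q : ℝ}
    (hp : p ∈ Icc a b) (hq : q ∈ Icc a b) :
    (q - p) • diffQuot a b hab.le γ (p, q) = γ q - γ p := by
  rw [diffQuot, intervalIntegral.smul_integral_comp_add_mul]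
  simp only [mul_zero, add_zero, mul_one, add_sub_cancel]
  exact integral_velocity hab hγ hp hq

lemma diffQuot_ne_zero (hab : a < b) (hγ : ContDiffOn ℝ ∞ γ (Icc a b)) (h : Embedded a b γ)
    {p q : ℝ} (hp : p ∈ Icc a b) (hq : q ∈ Icc a b) : diffQuot a b hab.le γ (p, q) ≠ 0 := by
  intro h0
  rcases eq_or_ne p q with rfl | hne
  · rw [diffQuot_self hab hp] at h0
    exact h.1 p hp h0
  · have h1 := sub_smul_diffQuot hab hγ hp hq
    rw [h0, smul_zero] at h1
    exact hne (h.2 hp hq (sub_eq_zero.1 h1.symm).symm)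

/-- A continuous angle that starts or ends at zero and never is an odd multiple of `π` is smaller
than `π` in absolute value. -/
lemma abs_lt_pi_of_exp_ne_neg_one {g : ℝ → ℝ} {x₀ : ℝ} (hg : ContinuousOn g (Icc a b))
    (hx₀ : x₀ ∈ Icc a b) (h0 : g x₀ = 0)
    (h : ∀ x ∈ Icc a b, Complex.exp (g x * Complex.I) ≠ -1) :
    ∀ x ∈ Icc a b, |g x| < Real.pi := by
  intro x hx
  by_contra! hge
  have hpre := (isPreconnected_Icc (a := a) (b := b)).image g hg
  have hord := hpre.ordConnected
  have m0 : (0 : ℝ) ∈ g '' Icc a b := ⟨x₀, hx₀, h0⟩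
  have mx : g x ∈ g '' Icc a b := ⟨x, hx, rfl⟩
  rcases le_abs'.1 hge with h1 | h1
  · obtain ⟨y, hy, hyx⟩ := hord.out mx m0 (show -Real.pi ∈ Icc (g x) 0 from
      ⟨h1, by linarith [Real.pi_pos]⟩)
    refine h y hy ?_
    rw [hyx]
    push_cast
    rw [neg_mul, Complex.exp_neg, Complex.exp_pi_mul_I]
    norm_num
  · obtain ⟨y, hy, hyx⟩ := hord.out m0 mx (show Real.pi ∈ Icc 0 (g x) from
      ⟨Real.pi_pos.le, h1⟩)
    exact h y hy (by rw [hyx, Complex.exp_pi_mul_I])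

/-- Serves to show that two continuous lifts of one direction differ by a constant. -/
lemma eq_zero_of_exp_eq_one {g : ℝ → ℝ} {x₀ : ℝ} (hg : ContinuousOn g (Icc a b))
    (hx₀ : x₀ ∈ Icc a b) (h0 : g x₀ = 0)
    (h : ∀ x ∈ Icc a b, Complex.exp (g x * Complex.I) = 1) :
    ∀ x ∈ Icc a b, g x = 0 := by
  intro x hx
  have hlt := abs_lt_pi_of_exp_ne_neg_one hg hx₀ h0 (fun y hy => by rw [h y hy]; norm_num) x hx
  have h1 := congrArg Complex.re (h x hx)
  rw [Complex.exp_ofReal_mul_I_re, Complex.one_re] at h1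
  rw [abs_lt] at hlt
  exact (Real.cos_eq_one_iff_of_lt_of_lt (by linarith [Real.pi_pos])
    (by linarith [Real.pi_pos])).1 h1

lemma exp_im_mul_I (z : ℂ) :
    Complex.exp z = (Real.exp z.re : ℝ) • Complex.exp (z.im * Complex.I) := by
  rw [Complex.real_smul, Complex.ofReal_exp, ← Complex.exp_add, Complex.re_add_im]

/-- An embedded curve that never meets the ray opposite to its initial tangent nor the prolongation
of its final tangent has total curvature smaller than `2π`. -/
theorem totalCurvature_lt_two_pi (hab : a < b) (hγ : ContDiffOn ℝ ∞ γ (Icc a b))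
    (h : Embedded a b γ)
    (hleft : ∀ q ∈ Ioc a b, ∀ r : ℝ, 0 < r → γ q ≠ γ a - r • tangent a b γ a)
    (hright : ∀ p ∈ Ico a b, ∀ r : ℝ, 0 < r → γ p ≠ γ b + r • tangent a b γ b) :
    totalCurvature a b γ < 2 * Real.pi := by
  obtain ⟨θ, hθc, -, hθ, hα⟩ := exists_tangent_angle hab hγ h.1
  -- Clamping both parameters extends the nonvanishing secant map to the whole plane, which is
  -- simply connected, so it has a continuous logarithm F.
  set P : ℝ → ℝ := fun x => projIcc a b hab.le x with hP
  have hPc : Continuous P := continuous_subtype_val.comp continuous_projIcc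
  have hPmem : ∀ x, P x ∈ Icc a b := fun x => (projIcc a b hab.le x).2
  have hPid : ∀ x ∈ Icc a b, P x = x := fun x hx => by simp only [hP, projIcc_of_mem hab.le hx]
  have ha : a ∈ Icc a b := left_mem_Icc.2 hab.le
  have hb : b ∈ Icc a b := right_mem_Icc.2 hab.le
  set H : C(ℝ × ℝ, ℂ) := ⟨fun x => diffQuot a b hab.le γ (P x.1, P x.2), by
    have := continuous_diffQuot hab hγ
    fun_prop⟩ with hH
  have hH0 : ∀ x, H x ∈ ({0}ᶜ : Set ℂ) := fun x =>
    diffQuot_ne_zero hab hγ h (hPmem x.1) (hPmem x.2)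
  obtain ⟨F, ⟨-, hF⟩, -⟩ := Complex.isCoveringMapOn_exp.existsUnique_continuousMap_lifts H
    (a₀ := (0, 0)) (e₀ := Complex.log (H (0, 0))) (Complex.exp_log (hH0 _)) hH0
  have hF' : ∀ p ∈ Icc a b, ∀ q ∈ Icc a b,
      Complex.exp (F (p, q)) = diffQuot a b hab.le γ (p, q) := by
    intro p hp q hq
    have := congrFun hF (p, q)
    simp only [Function.comp, hH, ContinuousMap.coe_mk, hPid p hp, hPid q hq] at this
    exact this
  set Θ : ℝ × ℝ → ℝ := fun x => (F x).im with hΘ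
  have hΘc : Continuous Θ := Complex.continuous_im.comp F.continuous
  have hdir : ∀ p ∈ Icc a b, ∀ q ∈ Icc a b, diffQuot a b hab.le γ (p, q) =
      (Real.exp (F (p, q)).re : ℝ) • Complex.exp (Θ (p, q) * Complex.I) := by
    intro p hp q hq
    rw [← hF' p hp q hq, exp_im_mul_I]
  have hdiag : ∀ p ∈ Icc a b,
      Complex.exp (Θ (p, p) * Complex.I) = Complex.exp (θ p * Complex.I) := by
    intro p hp
    have h1 := hdir p hp p hp
    rw [diffQuot_self hab hp, velocity_eq_smul_tangent (h.1 p hp), hθ p hp] at h1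
    have h2 := congrArg norm h1
    simp only [norm_smul, Complex.norm_exp_ofReal_mul_I, mul_one, Real.norm_eq_abs,
      Real.abs_exp, abs_norm] at h2
    rw [h2] at h1
    exact (smul_right_injective ℂ (Real.exp_pos _).ne' h1).symm
  have hquot : ∀ x y : ℝ, Complex.exp ((x - y : ℝ) * Complex.I) =
      Complex.exp (x * Complex.I) / Complex.exp (y * Complex.I) := by
    intro x y
    rw [← Complex.exp_sub, ← sub_mul]
    push_cast
    rfl
  -- On the diagonal the secant is the velocity, so Θ and θ lift the same direction.
  have hd : Θ (b, b) - Θ (a, a) = θ b - θ a := by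
    have := eq_zero_of_exp_eq_one (a := a) (b := b)
      (g := fun p => (Θ (p, p) - θ p) - (Θ (a, a) - θ a)) (x₀ := a) (by fun_prop) ha (by simp)
      (fun p hp => by
        rw [hquot, hquot, hquot, hdiag p hp, hdiag a ha, div_self (Complex.exp_ne_zero _),
          div_self (Complex.exp_ne_zero _), div_one]) b hb
    linarith
  -- A turn by π would make the secant from γ a opposite to the initial tangent. The edge ending at
  -- γ b is treated alike, and the two edges through (a, b) together give a turn below 2π.
  have hl := abs_lt_pi_of_exp_ne_neg_one (a := a) (b := b)
    (g := fun q => Θ (a, q) - Θ (a, a)) (x₀ := a) (by fun_prop) ha (by simp) (fun q hq hneg => by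
      rw [hquot, hdiag a ha, ← hθ a ha, div_eq_iff (by
        rw [hθ a ha]; exact Complex.exp_ne_zero _)] at hneg
      have h1 := hdir a ha q hq
      rw [hneg] at h1
      rcases eq_or_lt_of_le hq.1 with rfl | haq
      · rw [hdiag a ha, ← hθ a ha] at hneg
        have : tangent a b γ a = 0 := by linear_combination hneg / 2
        rw [hθ a ha] at this
        exact Complex.exp_ne_zero _ this
      · have h2 := sub_smul_diffQuot hab hγ ha hq
        rw [h1, smul_smul] at h2
        refine hleft q ⟨haq, hq.2⟩ ((q - a) * Real.exp (F (a, q)).re)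
          (mul_pos (sub_pos.2 haq) (Real.exp_pos _)) ?_
        rw [neg_one_mul, smul_neg] at h2
        linear_combination -h2) b hb
  have hr := abs_lt_pi_of_exp_ne_neg_one (a := a) (b := b)
    (g := fun p => Θ (p, b) - Θ (b, b)) (x₀ := b) (by fun_prop) hb (by simp) (fun p hp hneg => by
      rw [hquot, hdiag b hb, ← hθ b hb, div_eq_iff (by
        rw [hθ b hb]; exact Complex.exp_ne_zero _)] at hneg
      have h1 := hdir p hp b hb
      rw [hneg] at h1
      rcases eq_or_lt_of_le hp.2 with rfl | hpb
      · rw [hdiag p hb, ← hθ p hb] at hneg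
        have : tangent a p γ p = 0 := by linear_combination hneg / 2
        rw [hθ p hb] at this
        exact Complex.exp_ne_zero _ this
      · have h2 := sub_smul_diffQuot hab hγ hp hb
        rw [h1, smul_smul] at h2
        refine hright p ⟨hp.1, hpb⟩ ((b - p) * Real.exp (F (p, b)).re)
          (mul_pos (sub_pos.2 hpb) (Real.exp_pos _)) ?_
        rw [neg_one_mul, smul_neg] at h2
        linear_combination h2) a ha
  rw [abs_lt] at hl hr
  linarith

/-- A curve with positive curvature turns strictly to the left. -/
lemma leftTurning_of_curvature_pos (hab : a < b) (hγ : ContDiffOn ℝ ∞ γ (Icc a b))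
    (hr : Regular a b γ) (hκ : ∀ p ∈ Icc a b, 0 < curvature a b γ p) {θ : ℝ → ℝ}
    (hθc : Continuous θ)
    (hθ' : ∀ p ∈ Icc a b, HasDerivAt θ (curvature a b γ p * ‖velocity a b γ p‖) p)
    (hθ : ∀ p ∈ Icc a b, tangent a b γ p = Complex.exp (θ p * Complex.I)) :
    LeftTurning a b γ (fun p => ‖velocity a b γ p‖) θ where
  lt := hab
  continuousOn := hγ.continuousOn
  hasDerivAt p hp := by
    have hp' : p ∈ Icc a b := ⟨hp.1.le, hp.2.le⟩
    refine (hasDerivAt_of_mem_Ioo hγ hp).congr_deriv ?_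
    rw [← hθ p hp', ← Complex.real_smul]
    exact velocity_eq_smul_tangent (hr p hp')
  speed_pos p hp := norm_pos_iff.2 (hr p ⟨hp.1.le, hp.2.le⟩)
  strictMonoOn := strictMonoOn_of_deriv_pos (convex_Icc a b) hθc.continuousOn fun p hp => by
    have hp' := interior_subset hp
    rw [(hθ' p hp').deriv]
    exact mul_pos (hκ p hp') (norm_pos_iff.2 (hr p hp'))

end PlaneCurve

/-! ### Short curves meeting the support curve orthogonally. -/

namespace SupportCurve

variable {S : SupportCurve} {a b : ℝ} {γ : ℝ → ℂ}

lemma MeetsAtAngle.exists_eq_mul {x v : ℂ} {θ : ℝ} (h : S.MeetsAtAngle x v θ) (hv : ‖v‖ = 1) :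
    ∃ s, S.f s = x ∧ deriv S.f s = Complex.exp (θ * Complex.I) * v := by
  obtain ⟨s, hs, hθ⟩ := h
  refine ⟨s, hs, ?_⟩
  have h1 := (Complex.orientation.rotation_oangle_eq_iff_norm_eq v (deriv S.f s)).2
    (by rw [hv, S.unit_speed])
  rw [hθ, Complex.rotation] at h1
  rw [← h1]
  simp [Real.Angle.toCircle_coe, Circle.coe_exp]

lemma MeetsAtAngle.exists_left {x v : ℂ} (h : S.MeetsAtAngle x v (Real.pi / 2)) (hv : ‖v‖ = 1) :
    ∃ s, S.f s = x ∧ deriv S.f s = Complex.I * v := by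
  obtain ⟨s, hs, h1⟩ := h.exists_eq_mul hv
  refine ⟨s, hs, ?_⟩
  rw [h1]
  push_cast
  rw [Complex.exp_pi_div_two_mul_I]

lemma MeetsAtAngle.exists_right {x v : ℂ} (h : S.MeetsAtAngle x v (-(Real.pi / 2)))
    (hv : ‖v‖ = 1) : ∃ s, S.f s = x ∧ deriv S.f s = -(Complex.I * v) := by
  obtain ⟨s, hs, h1⟩ := h.exists_eq_mul hv
  refine ⟨s, hs, ?_⟩
  rw [h1]
  push_cast
  rw [neg_mul, Complex.exp_neg, Complex.exp_pi_div_two_mul_I, Complex.inv_I, neg_mul]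

/-- The inner normal ray meets the curve and its outer domain only at large distance. -/
lemma notMem_of_eq_add_normal {s : ℝ} {r : ℝ} (hr : 0 < r) (hrk : r < 1 / (2 * S.curvatureMax)) :
    S.f s + r • (Complex.I * deriv S.f s) ∉ S.outerDomain ∪ S.trace := by
  have hk := S.curvatureMax_pos
  rintro (h | ⟨s', hs'⟩)
  · refine S.notMem_outerDomain ?_ h
    rw [Complex.real_smul]
    refine S.add_normal_mem_region s hr.le ?_
    rw [lt_div_iff₀ (by positivity)] at hrk
    nlinarith
  -- A point of Σ this close has nearly the same inner normal, so f s would lie strictly to the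
  -- right of the tangent line at s'.
  · have h1 : ‖S.f s' - S.f s‖ < 1 / (2 * S.curvatureMax) := by
      rw [hs', add_sub_cancel_left, norm_smul, norm_mul, Complex.norm_I, S.unit_speed]
      simpa [abs_of_pos hr] using hrk
    have h2 := S.half_lt_inner_deriv h1
    have h3 := S.convex s s'
    have h4 : S.f s - S.f s' = -(r • (Complex.I * deriv S.f s)) := by rw [hs']; ring
    rw [h4, inner_neg_left, real_inner_smul_left] at h3
    have h5 : (inner ℝ (Complex.I * deriv S.f s) (Complex.I * deriv S.f s') : ℝ) =
        inner ℝ (deriv S.f s') (deriv S.f s) := by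
      simp only [↓inner_I_mul_right, inner_eq_re_im]
      simp
      ring
    rw [h5] at h3
    nlinarith

/-- The total curvature of a short curve that meets the support curve orthogonally is close to an
odd multiple of `π`. -/
lemma cos_totalCurvature_lt (hab : a < b) (hγ : ContDiffOn ℝ ∞ γ (Icc a b)) (hr : Regular a b γ)
    (hleft : S.MeetsAtAngle (γ a) (tangent a b γ a) (Real.pi / 2))
    (hright : S.MeetsAtAngle (γ b) (tangent a b γ b) (-(Real.pi / 2)))
    (hlen : length a b γ < 1 / (2 * S.curvatureMax)) :
    Real.cos (totalCurvature a b γ) < -(1 / 2) := by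
  have ha : a ∈ Icc a b := left_mem_Icc.2 hab.le
  have hb : b ∈ Icc a b := right_mem_Icc.2 hab.le
  obtain ⟨θ, -, -, hθ, hα⟩ := exists_tangent_angle hab hγ hr
  obtain ⟨s, hs, hs'⟩ := hleft.exists_left (norm_tangent (hr a ha))
  obtain ⟨t, ht, ht'⟩ := hright.exists_right (norm_tangent (hr b hb))
  have h1 : ‖S.f t - S.f s‖ < 1 / (2 * S.curvatureMax) := by
    rw [hs, ht]
    exact (norm_sub_le_length hab hγ ha hb).trans_lt hlen
  -- The tangents of Σ at the end points are Jτ(a) and -Jτ(b), whose inner product is -cos α.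
  have h2 := S.half_lt_inner_deriv h1
  rw [hs', ht', hθ a ha, hθ b hb] at h2
  rw [← hα, Real.cos_sub]
  have h3 : (inner ℝ (-(Complex.I * Complex.exp (θ b * Complex.I)))
      (Complex.I * Complex.exp (θ a * Complex.I)) : ℝ) =
      -(Real.cos (θ b) * Real.cos (θ a) + Real.sin (θ b) * Real.sin (θ a)) := by
    rw [inner_eq_normalComponent, normalComponent]
    simp only [Complex.neg_re, Complex.neg_im, Complex.mul_re, Complex.mul_im, Complex.I_re,
      Complex.I_im, Complex.exp_ofReal_mul_I_re, Complex.exp_ofReal_mul_I_im]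
    ring
  rw [h3] at h2
  linarith

/-- A short embedded curve in the outer domain that meets the support curve orthogonally has total
curvature smaller than `2π`. -/
lemma totalCurvature_lt_two_pi (hab : a < b) (hγ : ContDiffOn ℝ ∞ γ (Icc a b))
    (h : Embedded a b γ)
    (hleft : S.MeetsAtAngle (γ a) (tangent a b γ a) (Real.pi / 2))
    (hright : S.MeetsAtAngle (γ b) (tangent a b γ b) (-(Real.pi / 2)))
    (houter : ∀ p ∈ Ioo a b, γ p ∈ S.outerDomain)
    (hlen : length a b γ < 1 / (2 * S.curvatureMax)) :
    totalCurvature a b γ < 2 * Real.pi := by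
  have ha : a ∈ Icc a b := left_mem_Icc.2 hab.le
  have hb : b ∈ Icc a b := right_mem_Icc.2 hab.le
  have hta := norm_tangent (h.1 a ha)
  have htb := norm_tangent (h.1 b hb)
  obtain ⟨s, hs, hs'⟩ := hleft.exists_left hta
  obtain ⟨t, ht, ht'⟩ := hright.exists_right htb
  have hIs : Complex.I * deriv S.f s = -tangent a b γ a := by
    rw [hs', ← mul_assoc, Complex.I_mul_I, neg_one_mul]
  have hIt : Complex.I * deriv S.f t = tangent a b γ b := by
    rw [ht', mul_neg, ← mul_assoc, Complex.I_mul_I, neg_one_mul, neg_neg]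
  have hmem : ∀ p ∈ Icc a b, γ p ∈ S.outerDomain ∪ S.trace := by
    intro p hp
    rcases eq_or_lt_of_le hp.1 with rfl | h1
    · exact Or.inr ⟨s, hs⟩
    rcases eq_or_lt_of_le hp.2 with rfl | h2
    · exact Or.inr ⟨t, ht⟩
    exact Or.inl (houter p ⟨h1, h2⟩)
  have hnorm : ∀ {r : ℝ} {v : ℂ}, 0 < r → ‖v‖ = 1 → ‖r • v‖ = r := by
    intro r v hr hv
    rw [norm_smul, hv, mul_one, Real.norm_eq_abs, abs_of_pos hr]
  refine PlaneCurve.totalCurvature_lt_two_pi hab hγ h (fun q hq r hr0 heq => ?_)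
    (fun p hp r hr0 heq => ?_)
  · have hq' : q ∈ Icc a b := ⟨hq.1.le, hq.2⟩
    have h1 := norm_sub_le_length hab hγ ha hq'
    rw [heq, sub_sub_cancel_left, norm_neg, hnorm hr0 hta] at h1
    refine notMem_of_eq_add_normal (s := s) hr0 (h1.trans_lt hlen) ?_
    rw [hIs, hs, smul_neg, ← sub_eq_add_neg, ← heq]
    exact hmem q hq'
  · have hp' : p ∈ Icc a b := ⟨hp.1, hp.2.le⟩
    have h1 := norm_sub_le_length hab hγ hb hp'
    rw [heq, add_sub_cancel_left, hnorm hr0 htb] at h1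
    refine notMem_of_eq_add_normal (s := t) hr0 (h1.trans_lt hlen) ?_
    rw [hIt, ht, ← heq]
    exact hmem p hp'

/-- A short curve with positive curvature and total curvature smaller than `2π` that meets the
support curve orthogonally closes up with its chord to a convex curve. -/
theorem exists_convexArc (hab : a < b) (hγ : ContDiffOn ℝ ∞ γ (Icc a b)) (hr : Regular a b γ)
    (hκ : ∀ p ∈ Icc a b, 0 < PlaneCurve.curvature a b γ p)
    (hleft : S.MeetsAtAngle (γ a) (tangent a b γ a) (Real.pi / 2))
    (hright : S.MeetsAtAngle (γ b) (tangent a b γ b) (-(Real.pi / 2)))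
    (hlen : length a b γ < 1 / (2 * S.curvatureMax))
    (htot : totalCurvature a b γ < 2 * Real.pi) :
    ∃ ρ θ, LeftTurning.ConvexArc a b γ ρ θ := by
  have ha : a ∈ Icc a b := left_mem_Icc.2 hab.le
  have hb : b ∈ Icc a b := right_mem_Icc.2 hab.le
  obtain ⟨θ, hθc, hθ', hθ, hα⟩ := exists_tangent_angle hab hγ hr
  have hL := leftTurning_of_curvature_pos hab hγ hr hκ hθc hθ' hθ
  have hcos := cos_totalCurvature_lt hab hγ hr hleft hright hlen
  obtain ⟨s, hs, hs'⟩ := hleft.exists_left (norm_tangent (hr a ha))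
  obtain ⟨t, ht, ht'⟩ := hright.exists_right (norm_tangent (hr b hb))
  set α := totalCurvature a b γ
  set D := γ b - γ a with hD
  -- X and N are the tangential and normal coordinates of the chord in the frame at a. The
  -- half-plane conditions of Σ at its two end points say that the chord has nonpositive component
  -- along both τ(a) and τ(b).
  set X := D.re * Real.cos (θ a) + D.im * Real.sin (θ a) with hX
  set N := normalComponent (θ a) D with hN
  have hθb : θ b = θ a + α := by linarith
  have hX0 : X ≤ 0 := by
    have := S.convex t s
    rw [hs, ht, hs', hθ a ha, inner_I_mul_right, ← hD] at this
    simp only [Complex.mul_re, Complex.mul_im, Complex.I_re, Complex.I_im,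
      Complex.exp_ofReal_mul_I_re, Complex.exp_ofReal_mul_I_im] at this
    rw [hX]
    linarith
  have hY0 : X * Real.cos α + N * Real.sin α ≤ 0 := by
    have := S.convex s t
    rw [hs, ht, ht', hθ b hb, inner_I_mul_right, ← neg_sub (γ b), ← hD] at this
    simp only [Complex.mul_re, Complex.mul_im, Complex.I_re, Complex.I_im, Complex.neg_re,
      Complex.neg_im, Complex.exp_ofReal_mul_I_re, Complex.exp_ofReal_mul_I_im, hθb,
      Real.cos_add, Real.sin_add] at this
    rw [hX, hN, normalComponent]
    linarith
  have hN' : normalComponent (θ b) D = N * Real.cos α - X * Real.sin α := by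
    rw [hX, hN, normalComponent, normalComponent, hθb, Real.cos_add, Real.sin_add]
    ring
  have hα0 : 0 < α := by
    have := hL.strictMonoOn ha hb hab
    linarith
  have hXcos : 0 ≤ X * Real.cos α := mul_nonneg_of_nonpos_of_nonpos hX0 (by linarith)
  refine ⟨fun p => ‖velocity a b γ p‖, θ, ?_⟩
  rcases le_or_gt α Real.pi with hle | hgt
  -- For α ≤ π the monotone component gives N > 0, whereas N sin α ≤ -X cos α ≤ 0. Hence sin α = 0
  -- and α = π.
  · have hNpos : 0 < N := by
      have := hL.normalComponent_lt ha hb hab le_rfl (by linarith)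
      rw [hN, hD, normalComponent_sub]
      linarith
    have hsin0 : 0 ≤ Real.sin α := Real.sin_nonneg_of_nonneg_of_le_pi hα0.le hle
    have hsin : Real.sin α = 0 := by
      by_contra hne
      have := mul_pos hNpos (lt_of_le_of_ne hsin0 (Ne.symm hne))
      linarith
    have hαpi : α = Real.pi := by
      by_contra hne
      exact (Real.sin_pos_of_pos_of_lt_pi hα0 (lt_of_le_of_ne hle hne)).ne' hsin
    exact { hL with
      pi_le := by linarith
      lt_two_pi := by linarith
      left_pos := hNpos
      right_neg := by rw [← hD, hN', hsin]; nlinarith }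
  · have hsin : Real.sin α < 0 := by
      have := Real.sin_pos_of_pos_of_lt_pi (x := α - Real.pi) (by linarith) (by linarith)
      rw [Real.sin_sub_pi] at this
      linarith
    have hNnn : 0 ≤ N := by
      by_contra! hneg
      have := mul_pos_of_neg_of_neg hneg hsin
      linarith
    -- N = 0 would give X = 0, so the end points coincide. Co-coercivity then makes the two tangents
    -- of Σ equal, so τ(b) = -τ(a) and sin α = 0.
    have hNpos : 0 < N := by
      refine lt_of_le_of_ne hNnn fun h0 => ?_
      rw [← h0] at hY0
      have hX00 : X = 0 := by
        by_contra hne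
        have := mul_pos_of_neg_of_neg (lt_of_le_of_ne hX0 hne) (show Real.cos α < 0 by linarith)
        linarith
      have hDD : D.re ^ 2 + D.im ^ 2 = 0 := by
        have e1 : X ^ 2 + N ^ 2 = D.re ^ 2 + D.im ^ 2 := by
          rw [hX, hN, normalComponent]
          linear_combination (D.re ^ 2 + D.im ^ 2) * Real.sin_sq_add_cos_sq (θ a)
        rw [← e1, hX00, ← h0]; ring
      have hD0 : D = 0 := by
        apply Complex.ext <;> simp <;> nlinarith [sq_nonneg D.re, sq_nonneg D.im]
      have hst : S.f s = S.f t := by rw [hs, ht]; exact (sub_eq_zero.1 (hD ▸ hD0)).symm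
      have h1 := S.norm_deriv_sub_sq_le s t
      rw [hst, sub_self, inner_zero_left, mul_zero, hs', ht', sub_neg_eq_add, ← mul_add,
        norm_mul, Complex.norm_I, one_mul, hθ a ha, hθ b hb] at h1
      have h2 : Complex.exp (θ a * Complex.I) + Complex.exp (θ b * Complex.I) = 0 := by
        rw [← norm_eq_zero]
        exact pow_eq_zero_iff two_ne_zero |>.1 (le_antisymm h1 (sq_nonneg _))
      have h3 : Real.sin α = 0 := by
        have hre := congrArg Complex.re h2
        have him := congrArg Complex.im h2
        simp only [Complex.add_re, Complex.add_im, Complex.exp_ofReal_mul_I_re,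
          Complex.exp_ofReal_mul_I_im, Complex.zero_re, Complex.zero_im] at hre him
        rw [← hα, Real.sin_sub]
        linear_combination Real.cos (θ a) * him - Real.sin (θ a) * hre
      linarith
    exact { hL with
      pi_le := by linarith
      lt_two_pi := by linarith
      left_pos := hNpos
      right_neg := by
        rw [← hD, hN']
        have := mul_neg_of_pos_of_neg hNpos (show Real.cos α < 0 by linarith)
        have := mul_nonneg_of_nonpos_of_nonpos hX0 hsin.le
        linarith }

end SupportCurve

/-! ### Partial derivatives and parameter integrals on a strip with closed sides. -/

section Strip

variable {E : Type*} [NormedAddCommGroup E] [NormedSpace ℝ E] {a b : ℝ} {J : Set ℝ}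
  {F G : ℝ × ℝ → E} {x : ℝ × ℝ}

/-- The first partial derivative on the strip `[a,b] × ℝ`. -/
def partialFst (a b : ℝ) (F : ℝ × ℝ → E) (x : ℝ × ℝ) : E :=
  derivWithin (fun p => F (p, x.2)) (Icc a b) x.1

/-- The second partial derivative. -/
def partialSnd (F : ℝ × ℝ → E) (x : ℝ × ℝ) : E := deriv (fun t => F (x.1, t)) x.2

lemma uniqueDiffOn_strip (hab : a < b) (hJ : IsOpen J) : UniqueDiffOn ℝ (Icc a b ×ˢ J) :=
  (uniqueDiffOn_Icc hab).prod hJ.uniqueDiffOn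

lemma hasDerivWithinAt_fst_of_fderivWithin (hF : ContDiffOn ℝ ∞ F (Icc a b ×ˢ J))
    (hx : x ∈ Icc a b ×ˢ J) :
    HasDerivWithinAt (fun p => F (p, x.2)) (fderivWithin ℝ F (Icc a b ×ˢ J) x (1, 0))
      (Icc a b) x.1 := by
  have h1 := (hF.differentiableOn (by simp) x hx).hasFDerivWithinAt
  have h2 : HasDerivWithinAt (fun p : ℝ => (p, x.2)) ((1 : ℝ), (0 : ℝ)) (Icc a b) x.1 :=
    (hasDerivWithinAt_id x.1 _).prodMk (hasDerivWithinAt_const _ _ _)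
  exact h1.comp_hasDerivWithinAt x.1 h2
    (show MapsTo (fun p : ℝ => (p, x.2)) (Icc a b) (Icc a b ×ˢ J) from fun p hp => ⟨hp, hx.2⟩)

lemma hasDerivAt_snd_of_fderivWithin (hJ : IsOpen J) (hF : ContDiffOn ℝ ∞ F (Icc a b ×ˢ J))
    (hx : x ∈ Icc a b ×ˢ J) :
    HasDerivAt (fun t => F (x.1, t)) (fderivWithin ℝ F (Icc a b ×ˢ J) x (0, 1)) x.2 := by
  have h1 := (hF.differentiableOn (by simp) x hx).hasFDerivWithinAt
  have h2 : HasDerivWithinAt (fun t : ℝ => (x.1, t)) ((0 : ℝ), (1 : ℝ)) J x.2 :=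
    (hasDerivWithinAt_const _ _ _).prodMk (hasDerivWithinAt_id x.2 _)
  exact (h1.comp_hasDerivWithinAt x.2 h2
    (show MapsTo (fun t : ℝ => (x.1, t)) J (Icc a b ×ˢ J) from
      fun t ht => ⟨hx.1, ht⟩)).hasDerivAt (hJ.mem_nhds hx.2)

lemma partialFst_eq (hab : a < b) (hF : ContDiffOn ℝ ∞ F (Icc a b ×ˢ J))
    (hx : x ∈ Icc a b ×ˢ J) :
    partialFst a b F x = fderivWithin ℝ F (Icc a b ×ˢ J) x (1, 0) :=
  (hasDerivWithinAt_fst_of_fderivWithin hF hx).derivWithin (uniqueDiffOn_Icc hab x.1 hx.1)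

lemma partialSnd_eq (hJ : IsOpen J) (hF : ContDiffOn ℝ ∞ F (Icc a b ×ˢ J))
    (hx : x ∈ Icc a b ×ˢ J) :
    partialSnd F x = fderivWithin ℝ F (Icc a b ×ˢ J) x (0, 1) :=
  (hasDerivAt_snd_of_fderivWithin hJ hF hx).deriv

lemma hasDerivWithinAt_partialFst (hF : ContDiffOn ℝ ∞ F (Icc a b ×ˢ J))
    (hx : x ∈ Icc a b ×ˢ J) :
    HasDerivWithinAt (fun p => F (p, x.2)) (partialFst a b F x) (Icc a b) x.1 :=
  (hasDerivWithinAt_fst_of_fderivWithin hF hx).differentiableWithinAt.hasDerivWithinAt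

lemma hasDerivAt_partialSnd (hJ : IsOpen J) (hF : ContDiffOn ℝ ∞ F (Icc a b ×ˢ J))
    (hx : x ∈ Icc a b ×ˢ J) :
    HasDerivAt (fun t => F (x.1, t)) (partialSnd F x) x.2 :=
  (hasDerivAt_snd_of_fderivWithin hJ hF hx).differentiableAt.hasDerivAt

lemma contDiffOn_fderivWithin_strip (hab : a < b) (hJ : IsOpen J)
    (hF : ContDiffOn ℝ ∞ F (Icc a b ×ˢ J)) (v : ℝ × ℝ) :
    ContDiffOn ℝ ∞ (fun x => fderivWithin ℝ F (Icc a b ×ˢ J) x v) (Icc a b ×ˢ J) :=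
  (hF.fderivWithin (uniqueDiffOn_strip hab hJ) (by simp)).clm_apply contDiffOn_const

lemma contDiffOn_partialFst (hab : a < b) (hJ : IsOpen J)
    (hF : ContDiffOn ℝ ∞ F (Icc a b ×ˢ J)) :
    ContDiffOn ℝ ∞ (partialFst a b F) (Icc a b ×ˢ J) :=
  (contDiffOn_fderivWithin_strip hab hJ hF (1, 0)).congr fun _ hx => partialFst_eq hab hF hx

lemma contDiffOn_partialSnd (hab : a < b) (hJ : IsOpen J)
    (hF : ContDiffOn ℝ ∞ F (Icc a b ×ˢ J)) :
    ContDiffOn ℝ ∞ (partialSnd F) (Icc a b ×ˢ J) :=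
  (contDiffOn_fderivWithin_strip hab hJ hF (0, 1)).congr fun _ hx => partialSnd_eq hJ hF hx

lemma partialFst_congr (h : EqOn F G (Icc a b ×ˢ J)) (hx : x ∈ Icc a b ×ˢ J) :
    partialFst a b F x = partialFst a b G x :=
  derivWithin_congr (fun _ hp => h ⟨hp, hx.2⟩) (h hx)

lemma partialSnd_congr (hJ : IsOpen J) (h : EqOn F G (Icc a b ×ˢ J)) (hx : x ∈ Icc a b ×ˢ J) :
    partialSnd F x = partialSnd G x := by
  refine Filter.EventuallyEq.deriv_eq ?_
  filter_upwards [hJ.mem_nhds hx.2] with t ht using h ⟨hx.1, ht⟩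

/-- Partial derivatives on a strip commute. -/
theorem partialFst_partialSnd (hab : a < b) (hJ : IsOpen J)
    (hF : ContDiffOn ℝ ∞ F (Icc a b ×ˢ J)) (hx : x ∈ Icc a b ×ˢ J) :
    partialFst a b (partialSnd F) x = partialSnd (partialFst a b F) x := by
  have hs := uniqueDiffOn_strip hab hJ
  -- Symmetry reaches the boundary sides because the strip lies in the closure of its interior.
  have hsymm : IsSymmSndFDerivWithinAt ℝ F (Icc a b ×ˢ J) x := by
    refine (hF x hx).isSymmSndFDerivWithinAt (by simpa using ENat.LEInfty.out) hs ?_ hx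
    rw [interior_prod_eq, interior_Icc, hJ.interior_eq, closure_prod_eq, closure_Ioo hab.ne]
    exact ⟨hx.1, subset_closure hx.2⟩
  have hd : DifferentiableWithinAt ℝ (fderivWithin ℝ F (Icc a b ×ˢ J)) (Icc a b ×ˢ J) x :=
    (hF.fderivWithin hs (m := ∞) (by simp)).differentiableOn (by simp) x hx
  have happ : ∀ v w : ℝ × ℝ, fderivWithin ℝ (fun y => fderivWithin ℝ F (Icc a b ×ˢ J) y v) (Icc a b ×ˢ J) x w =
      fderivWithin ℝ (fderivWithin ℝ F (Icc a b ×ˢ J)) (Icc a b ×ˢ J) x w v := by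
    intro v w
    rw [fderivWithin_clm_apply (hs x hx) hd (differentiableWithinAt_const v)]
    simp
  rw [partialFst_congr (fun y hy => partialSnd_eq hJ hF hy) hx,
    partialSnd_congr hJ (fun y hy => partialFst_eq hab hF hy) hx,
    partialFst_eq hab (contDiffOn_fderivWithin_strip hab hJ hF _) hx,
    partialSnd_eq hJ (contDiffOn_fderivWithin_strip hab hJ hF _) hx, happ, happ]
  exact hsymm.eq _ _

/-- An integral over a compact interval depends continuously on a parameter. -/
lemma continuousOn_integral_of_continuousOn (hab : a ≤ b) {g : ℝ × ℝ → ℝ}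
    (hg : ContinuousOn g (Icc a b ×ˢ J)) :
    ContinuousOn (fun t => ∫ p in a..b, g (p, t)) J := by
  rw [continuousOn_iff_continuous_domRestrict]
  have h1 : Continuous fun t : J => ∫ p in a..b, g (projIcc a b hab p, t) := by
    refine intervalIntegral.continuous_parametric_intervalIntegral_of_continuous'
      (f := fun (t : J) p => g (projIcc a b hab p, t)) ?_ a b
    refine hg.comp_continuous (f := fun y : J × ℝ => ((projIcc a b hab y.2 : ℝ), (y.1 : ℝ)))
      ?_ fun y => ⟨(projIcc a b hab y.2).2, y.1.2⟩
    exact (continuous_subtype_val.comp (continuous_projIcc.comp continuous_snd)).prodMk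
      (continuous_subtype_val.comp continuous_fst)
  convert h1 using 2 with t
  refine intervalIntegral.integral_congr fun p hp => ?_
  rw [uIcc_of_le hab] at hp
  simp only [projIcc_of_mem hab hp]

/-- Differentiation under the integral sign on a strip. -/
lemma hasDerivAt_integral_strip (hab : a < b) (hJ : IsOpen J) {g : ℝ × ℝ → ℝ}
    (hg : ContDiffOn ℝ ∞ g (Icc a b ×ˢ J)) {t : ℝ} (ht : t ∈ J) :
    HasDerivAt (fun t => ∫ p in a..b, g (p, t)) (∫ p in a..b, partialSnd g (p, t)) t := by
  have hg' := (contDiffOn_partialSnd hab hJ hg).continuousOn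
  obtain ⟨ε, hε, hball⟩ := Metric.nhds_basis_closedBall.mem_iff.1 (hJ.mem_nhds ht)
  have hcomp : IsCompact (Icc a b ×ˢ Metric.closedBall t ε) :=
    isCompact_Icc.prod (isCompact_closedBall t ε)
  obtain ⟨M, hM⟩ := hcomp.exists_bound_of_continuousOn
    (hg'.mono (prod_mono_right hball))
  have hslice : ∀ {h : ℝ × ℝ → ℝ} {s : ℝ}, s ∈ J → ContinuousOn h (Icc a b ×ˢ J) →
      ContinuousOn (fun p => h (p, s)) (uIcc a b) := by
    intro h s hs hc
    rw [uIcc_of_le hab.le]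
    exact hc.comp (by fun_prop) fun p hp => ⟨hp, hs⟩
  have hsub : ∀ p ∈ uIoc a b, p ∈ Icc a b := by
    intro p hp
    rw [uIoc_of_le hab.le] at hp
    exact ⟨hp.1.le, hp.2⟩
  refine (intervalIntegral.hasDerivAt_integral_of_dominated_loc_of_deriv_le
    (F := fun t p => g (p, t)) (F' := fun t p => partialSnd g (p, t)) (bound := fun _ => M)
    (Metric.closedBall_mem_nhds t hε) ?_ (hslice ht hg.continuousOn).intervalIntegrable
    ((hslice ht hg').intervalIntegrable.aestronglyMeasurable_restrict_uIoc) ?_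
    intervalIntegrable_const ?_).2
  · filter_upwards [hJ.mem_nhds ht] with s hs
    exact (hslice hs hg.continuousOn).intervalIntegrable.aestronglyMeasurable_restrict_uIoc
  · exact Filter.Eventually.of_forall fun p hp s hs => hM (p, s) ⟨hsub p hp, hs⟩
  · exact Filter.Eventually.of_forall fun p hp s hs =>
      hasDerivAt_partialSnd hJ hg (x := (p, s)) ⟨hsub p hp, hball hs⟩

end Strip

/-! ### One-sided derivative tests at minima. -/

section OneVariable

variable {a b : ℝ}

lemma deriv_nonpos_of_forall_le_left {g : ℝ → ℝ} {g' s t : ℝ} (hg : HasDerivWithinAt g g' (Icc s t) t)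
    (hst : s < t) (h : ∀ r ∈ Icc s t, g t ≤ g r) : g' ≤ 0 := by
  have h1 := (hg.mono Ico_subset_Icc_self)
  rw [hasDerivWithinAt_iff_tendsto_slope' (by simp)] at h1
  have : (nhdsWithin t (Ico s t)).NeBot := by
    rw [nhdsWithin_Ico_eq_nhdsLT hst]; infer_instance
  refine le_of_tendsto h1 ?_
  filter_upwards [self_mem_nhdsWithin] with r hr
  rw [slope_def_field]
  exact div_nonpos_of_nonneg_of_nonpos (sub_nonneg.2 (h r ⟨hr.1, hr.2.le⟩)) (by linarith [hr.2])

lemma deriv_nonneg_of_forall_le_right {g : ℝ → ℝ} {g' s t : ℝ}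
    (hg : HasDerivWithinAt g g' (Icc s t) s)
    (hst : s < t) (h : ∀ r ∈ Icc s t, g s ≤ g r) : 0 ≤ g' := by
  have h1 := (hg.mono Ioc_subset_Icc_self)
  rw [hasDerivWithinAt_iff_tendsto_slope' (by simp)] at h1
  have : (nhdsWithin s (Ioc s t)).NeBot := by
    rw [nhdsWithin_Ioc_eq_nhdsGT hst]; infer_instance
  refine ge_of_tendsto h1 ?_
  filter_upwards [self_mem_nhdsWithin] with r hr
  rw [slope_def_field]
  exact div_nonneg (sub_nonneg.2 (h r ⟨hr.1.le, hr.2⟩)) (by linarith [hr.1])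

/-- The second-order condition at a minimum, for a derivative split off a positive factor. -/
lemma deriv_nonneg_of_isMinOn {f w ρ : ℝ → ℝ} {w' x : ℝ} (hab : a < b)
    (hf : ∀ p ∈ Icc a b, HasDerivWithinAt f (w p * ρ p) (Icc a b) p)
    (hρ : ∀ p ∈ Icc a b, 0 < ρ p) (hx : x ∈ Icc a b) (hmin : ∀ p ∈ Icc a b, f x ≤ f p)
    (hwx : w x = 0) (hw : HasDerivWithinAt w w' (Icc a b) x) : 0 ≤ w' := by
  by_contra! hneg
  rw [hasDerivWithinAt_iff_tendsto_slope] at hw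
  have hev := hw.eventually (gt_mem_nhds hneg)
  rw [eventually_nhdsWithin_iff, Metric.eventually_nhds_iff_ball] at hev
  obtain ⟨ε, hε, hball⟩ := hev
  have hsign : ∀ p ∈ Icc a b, p ≠ x → |p - x| < ε → w p / (p - x) < 0 := by
    intro p hp hpx hpε
    have := hball p (by rwa [Metric.mem_ball, Real.dist_eq]) ⟨hp, hpx⟩
    rwa [slope_def_field, hwx, sub_zero] at this
  have hcont : ContinuousOn f (Icc a b) := fun p hp => (hf p hp).continuousWithinAt
  have hder : ∀ p ∈ Ioo a b, HasDerivAt f (w p * ρ p) p := fun p hp =>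
    (hf p ⟨hp.1.le, hp.2.le⟩).hasDerivAt (Icc_mem_nhds hp.1 hp.2)
  -- If w' < 0, then f decreases away from x on each available side. One side suffices: the right
  -- one, unless x = b.
  rcases lt_or_ge x b with hxb | hxb
  · set y := min b (x + ε / 2)
    have hxy : x < y := lt_min hxb (by linarith)
    have hyb : y ≤ b := min_le_left _ _
    have hyε : y ≤ x + ε / 2 := min_le_right _ _
    obtain ⟨ξ, hξ, hξeq⟩ := exists_hasDerivAt_eq_slope f (fun p => w p * ρ p) hxy
      (hcont.mono (Icc_subset_Icc hx.1 hyb))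
      (fun p hp => hder p ⟨hx.1.trans_lt hp.1, hp.2.trans_le hyb⟩)
    have hξ' : ξ ∈ Icc a b := ⟨hx.1.trans hξ.1.le, hξ.2.le.trans hyb⟩
    have h1 := hsign ξ hξ' hξ.1.ne' (by
      rw [abs_of_pos (sub_pos.2 hξ.1)]; linarith [hξ.2])
    rw [div_neg_iff] at h1
    have h2 : w ξ < 0 := by
      rcases h1 with h1 | h1
      · linarith [h1.2, hξ.1]
      · exact h1.1
    have h3 : 0 ≤ (f y - f x) / (y - x) :=
      div_nonneg (sub_nonneg.2 (hmin y ⟨hx.1.trans hxy.le, hyb⟩)) (by linarith)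
    rw [← hξeq] at h3
    nlinarith [hρ ξ hξ']
  · obtain rfl : x = b := le_antisymm hx.2 hxb
    set y := max a (x - ε / 2)
    have hyx : y < x := max_lt hab (by linarith)
    have hay : a ≤ y := le_max_left _ _
    have hyε : x - ε / 2 ≤ y := le_max_right _ _
    obtain ⟨ξ, hξ, hξeq⟩ := exists_hasDerivAt_eq_slope f (fun p => w p * ρ p) hyx
      (hcont.mono (Icc_subset_Icc hay le_rfl))
      (fun p hp => hder p ⟨hay.trans_lt hp.1, hp.2⟩)
    have hξ' : ξ ∈ Icc a x := ⟨hay.trans hξ.1.le, hξ.2.le⟩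
    have h1 := hsign ξ hξ' hξ.2.ne (by
      rw [abs_of_neg (sub_neg.2 hξ.2)]; linarith [hξ.1])
    rw [div_neg_iff] at h1
    have h2 : 0 < w ξ := by
      rcases h1 with h1 | h1
      · exact h1.1
      · linarith [h1.2, hξ.2]
    have h3 : (f x - f y) / (x - y) ≤ 0 :=
      div_nonpos_of_nonpos_of_nonneg (sub_nonpos.2 (hmin y ⟨hay, hyx.le⟩)) (by linarith)
    rw [← hξeq] at h3
    nlinarith [hρ ξ hξ']

/-- Co-coercivity of increments passes to the derivatives. -/
lemma norm_sq_deriv_le_inner_deriv {X N : ℝ → ℂ} {X' N' : ℂ} {k t : ℝ} (hX : HasDerivAt X X' t)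
    (hN : HasDerivAt N N' t)
    (h : ∀ᶠ s in nhds t, ‖N s - N t‖ ^ 2 ≤ k * inner ℝ (X s - X t) (N s - N t)) :
    ‖N'‖ ^ 2 ≤ k * inner ℝ X' N' := by
  rw [hasDerivAt_iff_tendsto_slope] at hX hN
  refine le_of_tendsto_of_tendsto (hN.norm.pow 2) ((hX.inner hN).const_mul k) ?_
  filter_upwards [h.filter_mono nhdsWithin_le_nhds] with s hs
  simp only [slope_def_module, norm_smul, real_inner_smul_left, real_inner_smul_right, mul_pow,
    norm_inv, Real.norm_eq_abs, inv_pow, sq_abs]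
  have h1 : 0 ≤ ((s - t) ^ 2)⁻¹ := by positivity
  have h2 := mul_le_mul_of_nonneg_left hs h1
  refine h2.trans_eq ?_
  rw [← inv_pow]
  ring

end OneVariable

/-! ### Time intervals and the geometric quantities of a family of curves. -/

/-- The open interval of positive times. -/
def posTime (T : EReal) : Set ℝ := {t : ℝ | 0 < t ∧ (t : EReal) < T}

lemma isOpen_posTime (T : EReal) : IsOpen (posTime T) :=
  (isOpen_lt continuous_const continuous_id).inter
    (isOpen_lt continuous_coe_real_ereal continuous_const)

lemma posTime_subset (T : EReal) : posTime T ⊆ timeInterval T := fun _ ht => ⟨ht.1.le, ht.2⟩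

lemma mem_timeInterval_of_le {T : EReal} {s t : ℝ} (ht : t ∈ timeInterval T) (hs : 0 ≤ s)
    (hst : s ≤ t) : s ∈ timeInterval T :=
  ⟨hs, (EReal.coe_le_coe_iff.2 hst).trans_lt ht.2⟩

lemma ordConnected_timeInterval (T : EReal) : (timeInterval T).OrdConnected :=
  ⟨fun _ hs _ ht _ hr => mem_timeInterval_of_le ht (hs.1.trans hr.1) hr.2⟩

lemma interior_timeInterval_subset (T : EReal) : interior (timeInterval T) ⊆ posTime T := by
  intro t ht
  refine ⟨?_, (interior_subset ht).2⟩
  have h1 : timeInterval T ⊆ Ici 0 := fun _ h => h.1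
  have := interior_mono h1 ht
  rwa [interior_Ici] at this

/-- The speed of a family of curves. -/
def familySpeed (a b : ℝ) (c : ℝ → ℝ → ℂ) (x : ℝ × ℝ) : ℝ := ‖velocity a b (c · x.2) x.1‖

/-- The unit tangent of a family of curves. -/
def familyTangent (a b : ℝ) (c : ℝ → ℝ → ℂ) (x : ℝ × ℝ) : ℂ := tangent a b (c · x.2) x.1

/-- The curvature of a family of curves. -/
def familyCurvature (a b : ℝ) (c : ℝ → ℝ → ℂ) (x : ℝ × ℝ) : ℝ := curvature a b (c · x.2) x.1

/-- The difference of the curvature and its average. -/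
def normalSpeed (a b : ℝ) (c : ℝ → ℝ → ℂ) (x : ℝ × ℝ) : ℝ :=
  familyCurvature a b c x - meanCurvature a b (c · x.2)

/-- The arclength derivative of the curvature. -/
def curvatureSlope (a b : ℝ) (c : ℝ → ℝ → ℂ) (x : ℝ × ℝ) : ℝ :=
  partialFst a b (familyCurvature a b c) x / familySpeed a b c x

lemma mem_strip_of_posTime {a b : ℝ} {T : EReal} {x : ℝ × ℝ} (hx : x ∈ Icc a b ×ˢ posTime T) :
    x ∈ Icc a b ×ˢ timeInterval T := ⟨hx.1, posTime_subset T hx.2⟩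

lemma length_eq_integral_familySpeed (a b : ℝ) (c : ℝ → ℝ → ℂ) (t : ℝ) : length a b (c · t) = ∫ p in a..b, familySpeed a b c (p, t) := rfl

lemma totalCurvature_eq_integral_family (a b : ℝ) (c : ℝ → ℝ → ℂ) (t : ℝ) : totalCurvature a b (c · t) =
    ∫ p in a..b, familyCurvature a b c (p, t) * familySpeed a b c (p, t) := rfl

/-! ### Evolution equations, boundary inequalities and monotonicity of the length. -/

namespace IsSolution

variable {S : SupportCurve} {a b : ℝ} {T : EReal} {c₀ : ℝ → ℂ} {c : ℝ → ℝ → ℂ}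
  (h : IsSolution S a b T c₀ c) {x : ℝ × ℝ}
include h

lemma lt : a < b := h.initial.lt

lemma zero_mem : (0 : ℝ) ∈ timeInterval T := ⟨le_rfl, by simpa using h.time_pos⟩

/-- At t = 0 the joint regularity is too weak, and smoothness comes from c₀. -/
lemma contDiffOn_slice {t : ℝ} (ht : t ∈ timeInterval T) : ContDiffOn ℝ ∞ (c · t) (Icc a b) := by
  rcases eq_or_lt_of_le ht.1 with rfl | h0
  · exact h.initial.smooth.congr h.initial_eq
  · exact h.smooth.comp (f := fun p => (p, t)) (by fun_prop) fun p hp => ⟨hp, h0, ht.2⟩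

lemma speed_pos (hx : x ∈ Icc a b ×ˢ timeInterval T) : 0 < familySpeed a b c x :=
  norm_pos_iff.2 (h.regular x.2 hx.2 x.1 hx.1)

lemma norm_familyTangent (hx : x ∈ Icc a b ×ˢ timeInterval T) : ‖familyTangent a b c x‖ = 1 :=
  norm_tangent (h.regular x.2 hx.2 x.1 hx.1)

lemma continuousOn_speed : ContinuousOn (familySpeed a b c) (Icc a b ×ˢ timeInterval T) :=
  h.continuous_velocity.norm

lemma continuousOn_curvature :
    ContinuousOn (familyCurvature a b c) (Icc a b ×ˢ timeInterval T) := by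
  have h0 : ∀ x ∈ Icc a b ×ˢ timeInterval T, ‖velocity a b (c · x.2) x.1‖ ≠ 0 :=
    fun x hx => (h.speed_pos hx).ne'
  unfold familyCurvature curvature normal tangent
  exact (h.continuous_acceleration.inner (continuousOn_const.mul
    ((h.continuous_velocity.norm.inv₀ h0).smul h.continuous_velocity))).div
    (h.continuous_velocity.norm.pow 2) fun x hx => pow_ne_zero 2 (h0 x hx)

lemma contDiffOn_velocity :
    ContDiffOn ℝ ∞ (fun x : ℝ × ℝ => velocity a b (c · x.2) x.1) (Icc a b ×ˢ posTime T) :=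
  contDiffOn_partialFst h.lt (isOpen_posTime T) h.smooth

lemma contDiffOn_acceleration :
    ContDiffOn ℝ ∞ (fun x : ℝ × ℝ => acceleration a b (c · x.2) x.1) (Icc a b ×ˢ posTime T) :=
  contDiffOn_partialFst h.lt (isOpen_posTime T) h.contDiffOn_velocity

lemma contDiffOn_speed : ContDiffOn ℝ ∞ (familySpeed a b c) (Icc a b ×ˢ posTime T) :=
  h.contDiffOn_velocity.norm ℝ fun x hx => h.regular x.2 (posTime_subset T hx.2) x.1 hx.1

lemma contDiffOn_tangent : ContDiffOn ℝ ∞ (familyTangent a b c) (Icc a b ×ˢ posTime T) :=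
  (h.contDiffOn_speed.inv fun _ hx => (h.speed_pos (mem_strip_of_posTime hx)).ne').smul
    h.contDiffOn_velocity

lemma contDiffOn_curvature : ContDiffOn ℝ ∞ (familyCurvature a b c) (Icc a b ×ˢ posTime T) :=
  (h.contDiffOn_acceleration.inner ℝ (contDiffOn_const.mul h.contDiffOn_tangent)).div
    (h.contDiffOn_speed.pow 2)
    fun _ hx => pow_ne_zero 2 (h.speed_pos (mem_strip_of_posTime hx)).ne'

lemma contDiffOn_curvatureSlope :
    ContDiffOn ℝ ∞ (curvatureSlope a b c) (Icc a b ×ˢ posTime T) :=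
  (contDiffOn_partialFst h.lt (isOpen_posTime T) h.contDiffOn_curvature).div h.contDiffOn_speed
    fun _ hx => (h.speed_pos (mem_strip_of_posTime hx)).ne'

lemma partialFst_curvature (hx : x ∈ Icc a b ×ˢ timeInterval T) :
    partialFst a b (familyCurvature a b c) x = curvatureSlope a b c x * familySpeed a b c x := by
  rw [curvatureSlope, div_mul_cancel₀ _ (h.speed_pos hx).ne']

lemma hasDerivAt_time (hx : x ∈ Icc a b ×ˢ posTime T) :
    HasDerivAt (c x.1) (normalSpeed a b c x • (Complex.I * familyTangent a b c x)) x.2 := by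
  refine (h.evolution x.1 hx.1 x.2 (posTime_subset T hx.2)).hasDerivAt ?_
  exact Filter.mem_of_superset ((isOpen_posTime T).mem_nhds hx.2) (posTime_subset T)

lemma hasDerivWithinAt_tangent_space (hx : x ∈ Icc a b ×ˢ timeInterval T) :
    HasDerivWithinAt (fun p => familyTangent a b c (p, x.2))
      ((familyCurvature a b c x * familySpeed a b c x) • (Complex.I * familyTangent a b c x))
      (Icc a b) x.1 :=
  hasDerivWithinAt_tangent h.lt (h.contDiffOn_slice hx.2) (h.regular x.2 hx.2) hx.1

lemma hasDerivWithinAt_curvature_space (hx : x ∈ Icc a b ×ˢ posTime T) :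
    HasDerivWithinAt (fun p => familyCurvature a b c (p, x.2))
      (curvatureSlope a b c x * familySpeed a b c x) (Icc a b) x.1 := by
  rw [← h.partialFst_curvature (mem_strip_of_posTime hx)]
  exact hasDerivWithinAt_partialFst h.contDiffOn_curvature hx

/-- The evolution of the velocity. -/
lemma hasDerivAt_velocity_time (hx : x ∈ Icc a b ×ˢ posTime T) :
    HasDerivAt (fun t => velocity a b (c · t) x.1)
      ((curvatureSlope a b c x * familySpeed a b c x) • (Complex.I * familyTangent a b c x) -
        (normalSpeed a b c x * familyCurvature a b c x * familySpeed a b c x) •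
          familyTangent a b c x) x.2 := by
  have h1 := hasDerivAt_partialSnd (isOpen_posTime T) h.contDiffOn_velocity hx
  refine h1.congr_deriv ?_
  -- The time derivative of the velocity is the spatial derivative of V Jτ.
  have h2 := partialFst_partialSnd h.lt (isOpen_posTime T) h.smooth hx
  change _ = partialSnd (fun x : ℝ × ℝ => velocity a b (c · x.2) x.1) x at h2
  rw [← h2]
  have h3 : EqOn (partialSnd fun x : ℝ × ℝ => c x.1 x.2)
      (fun x => normalSpeed a b c x • (Complex.I * familyTangent a b c x))
      (Icc a b ×ˢ posTime T) := fun y hy => (h.hasDerivAt_time hy).deriv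
  rw [partialFst_congr h3 hx]
  have h4 : HasDerivWithinAt (fun p => normalSpeed a b c (p, x.2))
      (curvatureSlope a b c x * familySpeed a b c x) (Icc a b) x.1 :=
    (h.hasDerivWithinAt_curvature_space hx).sub_const (meanCurvature a b (c · x.2))
  have h5 := h4.smul ((h.hasDerivWithinAt_tangent_space (mem_strip_of_posTime hx)).const_mul Complex.I)
  refine (h5.derivWithin (uniqueDiffOn_Icc h.lt x.1 hx.1)).trans ?_
  simp only [Complex.real_smul]
  push_cast
  linear_combination (normalSpeed a b c x * familyCurvature a b c x * familySpeed a b c x *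
    familyTangent a b c x : ℂ) * Complex.I_mul_I

/-- The evolution of the line element. -/
lemma hasDerivAt_speed_time (hx : x ∈ Icc a b ×ˢ posTime T) :
    HasDerivAt (fun t => familySpeed a b c (x.1, t))
      (-(normalSpeed a b c x * familyCurvature a b c x * familySpeed a b c x)) x.2 := by
  have hx' := mem_strip_of_posTime hx
  have h1 := hasDerivWithinAt_norm (h.hasDerivAt_velocity_time hx).hasDerivWithinAt (s := univ)
    (h.regular x.2 hx'.2 x.1 hx.1)
  rw [hasDerivWithinAt_univ] at h1
  refine h1.congr_deriv ?_
  change (inner ℝ _ (familyTangent a b c x) : ℝ) = _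
  rw [inner_sub_left, real_inner_smul_left, real_inner_smul_left,
    real_inner_self_eq_norm_sq, h.norm_familyTangent hx', real_inner_comm, inner_I_mul_right]
  ring

/-- The evolution of the unit tangent. -/
lemma hasDerivAt_tangent_time (hx : x ∈ Icc a b ×ˢ posTime T) :
    HasDerivAt (fun t => familyTangent a b c (x.1, t))
      (curvatureSlope a b c x • (Complex.I * familyTangent a b c x)) x.2 := by
  have hx' := mem_strip_of_posTime hx
  have h1 := hasDerivWithinAt_unit (h.hasDerivAt_velocity_time hx).hasDerivWithinAt (s := univ)
    (h.regular x.2 hx'.2 x.1 hx.1)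
  rw [hasDerivWithinAt_univ] at h1
  refine h1.congr_deriv ?_
  change (inner ℝ _ (Complex.I * familyTangent a b c x) / familySpeed a b c x) •
    (Complex.I * familyTangent a b c x) = _
  congr 1
  rw [inner_sub_left, real_inner_smul_left, real_inner_smul_left,
    real_inner_self_eq_norm_sq, norm_mul, Complex.norm_I, h.norm_familyTangent hx',
    inner_I_mul_right]
  have := (h.speed_pos hx').ne'
  field_simp
  ring

/-- The evolution equation of the curvature. -/
theorem partialSnd_curvature_mul_speed (hx : x ∈ Icc a b ×ˢ posTime T) :
    partialSnd (familyCurvature a b c) x * familySpeed a b c x =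
      partialFst a b (curvatureSlope a b c) x +
        normalSpeed a b c x * familyCurvature a b c x ^ 2 * familySpeed a b c x := by
  have hx' := mem_strip_of_posTime hx
  -- Equality of the mixed derivatives of τ: the parts along τ cancel, and the coefficient of Jτ is
  -- the evolution equation.
  have h1 := partialFst_partialSnd h.lt (isOpen_posTime T) h.contDiffOn_tangent hx
  have e1 : EqOn (partialSnd (familyTangent a b c))
      (fun x => curvatureSlope a b c x • (Complex.I * familyTangent a b c x))
      (Icc a b ×ˢ posTime T) := fun y hy => (h.hasDerivAt_tangent_time hy).deriv
  have e2 : EqOn (partialFst a b (familyTangent a b c))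
      (fun x => (familyCurvature a b c x * familySpeed a b c x) •
        (Complex.I * familyTangent a b c x))
      (Icc a b ×ˢ posTime T) := fun y hy =>
    (h.hasDerivWithinAt_tangent_space (mem_strip_of_posTime hy)).derivWithin
      (uniqueDiffOn_Icc h.lt y.1 hy.1)
  rw [partialFst_congr e1 hx, partialSnd_congr (isOpen_posTime T) e2 hx] at h1
  have d1 := (hasDerivWithinAt_partialFst h.contDiffOn_curvatureSlope hx).smul
    ((h.hasDerivWithinAt_tangent_space hx').const_mul Complex.I)
  have d2 := ((hasDerivAt_partialSnd (isOpen_posTime T) h.contDiffOn_curvature hx).mul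
    (h.hasDerivAt_speed_time hx)).smul ((h.hasDerivAt_tangent_time hx).const_mul Complex.I)
  have h2 := (d1.derivWithin (uniqueDiffOn_Icc h.lt x.1 hx.1)).symm.trans (h1.trans d2.deriv)
  simp only [Pi.mul_apply, Prod.mk.eta, Complex.real_smul] at h2
  push_cast at h2
  have hτ : familyTangent a b c x ≠ 0 := norm_ne_zero_iff.1 (by
    rw [h.norm_familyTangent hx']; exact one_ne_zero)
  have h3 : (Complex.I * familyTangent a b c x) ≠ 0 := mul_ne_zero Complex.I_ne_zero hτ
  have h4 : ((partialSnd (familyCurvature a b c) x * familySpeed a b c x : ℝ) : ℂ) =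
      ((partialFst a b (curvatureSlope a b c) x +
        normalSpeed a b c x * familyCurvature a b c x ^ 2 * familySpeed a b c x : ℝ) : ℂ) := by
    refine mul_right_cancel₀ h3 ?_
    push_cast
    linear_combination -h2
  exact_mod_cast h4

/-- The arclength derivative of the curvature at the left end point is controlled by the normal
speed. -/
lemma sq_curvatureSlope_left {t : ℝ} (ht : t ∈ posTime T) :
    curvatureSlope a b c (a, t) ^ 2 ≤
      S.curvatureMax * (normalSpeed a b c (a, t) * curvatureSlope a b c (a, t)) := by
  have hx : (a, t) ∈ Icc a b ×ˢ posTime T := ⟨left_mem_Icc.2 h.lt.le, ht⟩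
  have hnorm : ∀ s ∈ posTime T, ‖familyTangent a b c (a, s)‖ = 1 := fun s hs =>
    h.norm_familyTangent ⟨hx.1, posTime_subset T hs⟩
  -- Since f' = Jτ at the end point, co-coercivity compares c(a, ·) and τ(a, ·) at nearby times.
  -- This replaces differentiating the boundary condition and needs no differentiable choice of the
  -- parameter on Σ.
  have key := norm_sq_deriv_le_inner_deriv (k := S.curvatureMax) (h.hasDerivAt_time hx)
    (h.hasDerivAt_tangent_time hx) (by
      filter_upwards [(isOpen_posTime T).mem_nhds ht] with s hs
      obtain ⟨σ, hσ, hσ'⟩ := (h.angle_left s (posTime_subset T hs)).exists_left (hnorm s hs)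
      obtain ⟨σ₀, hσ₀, hσ₀'⟩ := (h.angle_left t (posTime_subset T ht)).exists_left (hnorm t ht)
      have h1 := S.norm_deriv_sub_sq_le σ σ₀
      rw [hσ, hσ₀, hσ', hσ₀', ← mul_sub, ← mul_sub, ← mul_assoc, Complex.I_mul_I, neg_one_mul,
        neg_sub, norm_mul, Complex.norm_I, one_mul] at h1
      exact h1)
  rw [norm_smul, norm_mul, Complex.norm_I, hnorm t ht, real_inner_smul_left, real_inner_smul_right,
    real_inner_self_eq_norm_sq, norm_mul, Complex.norm_I, hnorm t ht] at key
  simpa using key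

/-- The arclength derivative of the curvature at the right end point is controlled by the normal
speed. -/
lemma sq_curvatureSlope_right {t : ℝ} (ht : t ∈ posTime T) :
    curvatureSlope a b c (b, t) ^ 2 ≤
      -(S.curvatureMax * (normalSpeed a b c (b, t) * curvatureSlope a b c (b, t))) := by
  have hx : (b, t) ∈ Icc a b ×ˢ posTime T := ⟨right_mem_Icc.2 h.lt.le, ht⟩
  have hnorm : ∀ s ∈ posTime T, ‖familyTangent a b c (b, s)‖ = 1 := fun s hs =>
    h.norm_familyTangent ⟨hx.1, posTime_subset T hs⟩
  -- Here f' = -Jτ, which reverses the sign.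
  have key := norm_sq_deriv_le_inner_deriv (k := -S.curvatureMax) (h.hasDerivAt_time hx)
    (h.hasDerivAt_tangent_time hx) (by
      filter_upwards [(isOpen_posTime T).mem_nhds ht] with s hs
      obtain ⟨σ, hσ, hσ'⟩ := (h.angle_right s (posTime_subset T hs)).exists_right (hnorm s hs)
      obtain ⟨σ₀, hσ₀, hσ₀'⟩ := (h.angle_right t (posTime_subset T ht)).exists_right (hnorm t ht)
      have h1 := S.norm_deriv_sub_sq_le σ σ₀
      rw [hσ, hσ₀, hσ', hσ₀', neg_sub_neg, neg_sub_neg, ← mul_sub, ← mul_sub, ← mul_assoc,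
        Complex.I_mul_I, neg_one_mul, inner_neg_right, mul_neg, norm_mul, Complex.norm_I, one_mul,
        norm_sub_rev] at h1
      rw [neg_mul]
      exact h1)
  rw [norm_smul, norm_mul, Complex.norm_I, hnorm t ht, real_inner_smul_left, real_inner_smul_right,
    real_inner_self_eq_norm_sq, norm_mul, Complex.norm_I, hnorm t ht] at key
  simpa using key

lemma continuousOn_slice {g : ℝ × ℝ → ℝ} (hg : ContinuousOn g (Icc a b ×ˢ timeInterval T)) {t : ℝ}
    (ht : t ∈ timeInterval T) : ContinuousOn (fun p => g (p, t)) (uIcc a b) := by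
  rw [uIcc_of_le h.lt.le]
  exact hg.comp (by fun_prop) fun p hp => ⟨hp, ht⟩

lemma length_pos {t : ℝ} (ht : t ∈ timeInterval T) : 0 < length a b (c · t) := by
  rw [length_eq_integral_familySpeed]
  refine intervalIntegral.intervalIntegral_pos_of_pos_on
    (h.continuousOn_slice h.continuousOn_speed ht).intervalIntegrable (fun p hp => ?_) h.lt
  exact h.speed_pos (x := (p, t)) ⟨⟨hp.1.le, hp.2.le⟩, ht⟩

lemma meanCurvature_mul_length {t : ℝ} (ht : t ∈ timeInterval T) :
    meanCurvature a b (c · t) * length a b (c · t) = totalCurvature a b (c · t) :=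
  div_mul_cancel₀ _ (h.length_pos ht).ne'

lemma continuousOn_length : ContinuousOn (fun t => length a b (c · t)) (timeInterval T) :=
  continuousOn_integral_of_continuousOn h.lt.le h.continuousOn_speed

lemma continuousOn_totalCurvature :
    ContinuousOn (fun t => totalCurvature a b (c · t)) (timeInterval T) :=
  continuousOn_integral_of_continuousOn h.lt.le (h.continuousOn_curvature.mul h.continuousOn_speed)

lemma intervalIntegrable_curvature_speed {t : ℝ} (ht : t ∈ timeInterval T) :
    IntervalIntegrable (fun p => familyCurvature a b c (p, t) * familySpeed a b c (p, t))
      MeasureTheory.volume a b :=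
  (h.continuousOn_slice (h.continuousOn_curvature.mul h.continuousOn_speed) ht).intervalIntegrable

lemma le_meanCurvature {t m : ℝ} (ht : t ∈ timeInterval T)
    (hm : ∀ p ∈ Icc a b, m ≤ familyCurvature a b c (p, t)) : m ≤ meanCurvature a b (c · t) := by
  refine (le_div_iff₀ (h.length_pos ht)).2 ?_
  rw [length_eq_integral_familySpeed, ← intervalIntegral.integral_const_mul]
  refine intervalIntegral.integral_mono_on h.lt.le
    ((h.continuousOn_slice h.continuousOn_speed ht).intervalIntegrable.const_mul m)
    (h.intervalIntegrable_curvature_speed ht) fun p hp => ?_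
  exact mul_le_mul_of_nonneg_right (hm p hp) (h.speed_pos (x := (p, t)) ⟨hp, ht⟩).le

lemma meanCurvature_le {t m : ℝ} (ht : t ∈ timeInterval T)
    (hm : ∀ p ∈ Icc a b, familyCurvature a b c (p, t) ≤ m) : meanCurvature a b (c · t) ≤ m := by
  refine (div_le_iff₀ (h.length_pos ht)).2 ?_
  rw [length_eq_integral_familySpeed, ← intervalIntegral.integral_const_mul]
  refine intervalIntegral.integral_mono_on h.lt.le
    (h.intervalIntegrable_curvature_speed ht)
    ((h.continuousOn_slice h.continuousOn_speed ht).intervalIntegrable.const_mul m) fun p hp => ?_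
  exact mul_le_mul_of_nonneg_right (hm p hp) (h.speed_pos (x := (p, t)) ⟨hp, ht⟩).le

/-- The length does not increase. -/
theorem antitoneOn_length : AntitoneOn (fun t => length a b (c · t)) (timeInterval T) := by
  have hder : ∀ t ∈ posTime T, HasDerivAt (fun t => length a b (c · t))
      (-∫ p in a..b, normalSpeed a b c (p, t) ^ 2 * familySpeed a b c (p, t)) t := by
    intro t ht
    have ht' := posTime_subset T ht
    refine (hasDerivAt_integral_strip h.lt (isOpen_posTime T) h.contDiffOn_speed ht).congr_deriv ?_
    set m := meanCurvature a b (c · t) with hm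
    -- With κ = V + m, -Vκ = -V² - (mκ - m²), and the bracket integrates to zero because m is the
    -- average of κ.
    have e1 : ∫ p in a..b, partialSnd (familySpeed a b c) (p, t) = ∫ p in a..b,
        (-(normalSpeed a b c (p, t) ^ 2 * familySpeed a b c (p, t)) -
          (m * (familyCurvature a b c (p, t) * familySpeed a b c (p, t)) -
            m ^ 2 * familySpeed a b c (p, t))) := by
      refine intervalIntegral.integral_congr fun p hp => ?_
      rw [uIcc_of_le h.lt.le] at hp
      have h1 := (h.hasDerivAt_speed_time (x := (p, t)) ⟨hp, ht⟩).deriv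
      change partialSnd (familySpeed a b c) (p, t) = _ at h1
      simp only [h1, normalSpeed, ← hm]
      ring
    have i1 := h.intervalIntegrable_curvature_speed ht'
    have i2 := (h.continuousOn_slice h.continuousOn_speed ht').intervalIntegrable
      (μ := MeasureTheory.volume)
    have i3 : IntervalIntegrable
        (fun p => normalSpeed a b c (p, t) ^ 2 * familySpeed a b c (p, t))
        MeasureTheory.volume a b := by
      have hc := h.continuousOn_slice h.continuousOn_curvature ht'
      exact (((hc.sub (continuousOn_const (c := m))).pow 2).mul
        (h.continuousOn_slice h.continuousOn_speed ht')).intervalIntegrable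
    have i4 : IntervalIntegrable
        (fun p => -(normalSpeed a b c (p, t) ^ 2 * familySpeed a b c (p, t)))
        MeasureTheory.volume a b := i3.neg
    rw [e1, intervalIntegral.integral_sub i4 ((i1.const_mul m).sub (i2.const_mul _)),
      intervalIntegral.integral_sub (i1.const_mul m) (i2.const_mul _),
      intervalIntegral.integral_const_mul, intervalIntegral.integral_const_mul,
      intervalIntegral.integral_neg, ← totalCurvature_eq_integral_family,
      ← length_eq_integral_familySpeed,
      ← h.meanCurvature_mul_length ht']
    ring
  refine antitoneOn_of_deriv_nonpos (ordConnected_timeInterval T).convex h.continuousOn_length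
    (fun t ht => (hder t (interior_timeInterval_subset T ht)).differentiableAt.differentiableWithinAt)
    fun t ht => ?_
  have ht' := interior_timeInterval_subset T ht
  rw [(hder t ht').deriv, neg_nonpos]
  refine intervalIntegral.integral_nonneg h.lt.le fun p hp => ?_
  exact mul_nonneg (sq_nonneg _) (h.speed_pos (x := (p, t)) ⟨hp, posTime_subset T ht'⟩).le

end IsSolution

/-! ### Maximum principle for the curvature, and persistence of the total curvature bound. -/

namespace IsSolution

variable {S : SupportCurve} {a b : ℝ} {T : EReal} {c₀ : ℝ → ℂ} {c : ℝ → ℝ → ℂ}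
  (h : IsSolution S a b T c₀ c)
include h

/-- At a spatial minimum of the curvature the derivative of the curvature vanishes, also at the
end points. -/
lemma curvatureSlope_eq_zero {p t : ℝ} (hp : p ∈ Icc a b) (ht : t ∈ posTime T)
    (hmin : ∀ q ∈ Icc a b, familyCurvature a b c (p, t) ≤ familyCurvature a b c (q, t)) :
    curvatureSlope a b c (p, t) = 0 := by
  have ht' := posTime_subset T ht
  have hder := h.hasDerivWithinAt_curvature_space (x := (p, t)) ⟨hp, ht⟩
  have hρ := h.speed_pos (x := (p, t)) ⟨hp, ht'⟩
  have hV : normalSpeed a b c (p, t) ≤ 0 := sub_nonpos.2 (h.le_meanCurvature ht' hmin)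
  have hk := S.curvatureMax_pos
  simp only at hder
  -- At a minimum V ≤ 0. At the left end κ_s ≥ 0 and at the right end κ_s ≤ 0, so in both cases the
  -- boundary inequality gives κ_s² ≤ 0.
  rcases eq_or_lt_of_le hp.1 with rfl | hap
  · have h1 := deriv_nonneg_of_forall_le_right hder h.lt hmin
    have h2 : 0 ≤ curvatureSlope a b c (a, t) := nonneg_of_mul_nonneg_left h1 hρ
    have h3 := h.sq_curvatureSlope_left ht
    have h4 := mul_nonneg hk.le (mul_nonneg (neg_nonneg.2 hV) h2)
    exact pow_eq_zero_iff two_ne_zero |>.1 (le_antisymm (by linarith) (sq_nonneg _))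
  rcases eq_or_lt_of_le hp.2 with rfl | hpb
  · have h1 := deriv_nonpos_of_forall_le_left hder h.lt hmin
    have h2 : curvatureSlope a p c (p, t) ≤ 0 := by
      by_contra! h5
      linarith [mul_pos h5 hρ]
    have h3 := h.sq_curvatureSlope_right ht
    have h4 := mul_nonneg hk.le (mul_nonneg_of_nonpos_of_nonpos hV h2)
    exact pow_eq_zero_iff two_ne_zero |>.1 (le_antisymm (by linarith) (sq_nonneg _))
  · have h1 : IsLocalMin (fun q => familyCurvature a b c (q, t)) p := by
      filter_upwards [Icc_mem_nhds hap hpb] with q hq using hmin q hq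
    have h2 := h1.hasDerivAt_eq_zero (hder.hasDerivAt (Icc_mem_nhds hap hpb))
    exact (mul_eq_zero.1 h2).resolve_right hρ.ne'

/-- The curvature equation at a spatial minimum of the curvature. -/
lemma le_partialSnd_curvature {p t : ℝ} (hp : p ∈ Icc a b) (ht : t ∈ posTime T)
    (hmin : ∀ q ∈ Icc a b, familyCurvature a b c (p, t) ≤ familyCurvature a b c (q, t)) :
    normalSpeed a b c (p, t) * familyCurvature a b c (p, t) ^ 2 ≤
      partialSnd (familyCurvature a b c) (p, t) := by
  have ht' := posTime_subset T ht
  have hx : (p, t) ∈ Icc a b ×ˢ posTime T := ⟨hp, ht⟩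
  have hder : ∀ q ∈ Icc a b, HasDerivWithinAt (fun q => familyCurvature a b c (q, t))
      (curvatureSlope a b c (q, t) * familySpeed a b c (q, t)) (Icc a b) q :=
    fun q hq => h.hasDerivWithinAt_curvature_space (x := (q, t)) ⟨hq, ht⟩
  have hslope : HasDerivWithinAt (fun q => curvatureSlope a b c (q, t))
      (partialFst a b (curvatureSlope a b c) (p, t)) (Icc a b) p :=
    hasDerivWithinAt_partialFst (F := curvatureSlope a b c) (x := (p, t))
      h.contDiffOn_curvatureSlope hx
  have hspeed : ∀ q ∈ Icc a b, 0 < familySpeed a b c (q, t) :=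
    fun q hq => h.speed_pos (x := (q, t)) ⟨hq, ht'⟩
  have hw := deriv_nonneg_of_isMinOn h.lt hder hspeed hp hmin
    (h.curvatureSlope_eq_zero hp ht hmin) hslope
  have h1 := h.partialSnd_curvature_mul_speed hx
  refine le_of_mul_le_mul_right ?_ (hspeed p hp)
  linarith

/-- A quantitative lower bound for the curvature as long as it is positive. -/
lemma le_curvature_of_pos {s M m : ℝ} (hs : s ∈ timeInterval T)
    (hm0 : ∀ p ∈ Icc a b, m ≤ familyCurvature a b c (p, 0))
    (hM : ∀ t ∈ Icc 0 s, ∀ p ∈ Icc a b, familyCurvature a b c (p, t) ≤ M)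
    (hpos : ∀ t ∈ Icc 0 s, ∀ p ∈ Icc a b, 0 < familyCurvature a b c (p, t)) {p : ℝ}
    (hp : p ∈ Icc a b) : m * Real.exp (-((M ^ 2 + 1) * s)) ≤ familyCurvature a b c (p, s) := by
  set K := M ^ 2 + 1 with hK
  have hmem : ∀ t ∈ Icc 0 s, t ∈ timeInterval T := fun t ht => mem_timeInterval_of_le hs ht.1 ht.2
  have hsub : Icc a b ×ˢ Icc 0 s ⊆ Icc a b ×ˢ timeInterval T := prod_mono_right hmem
  have hs0 : s ∈ Icc 0 s := right_mem_Icc.2 hs.1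
  -- At a minimum of κ the reaction term satisfies Vκ² ≥ -M²κ, so a growth rate above M² excludes a
  -- minimum of W at a positive time.
  set W : ℝ × ℝ → ℝ := fun x => Real.exp (K * x.2) * familyCurvature a b c x with hW
  have hWc : ContinuousOn W (Icc a b ×ˢ Icc 0 s) := by
    have h1 : Continuous fun x : ℝ × ℝ => Real.exp (K * x.2) := by fun_prop
    exact h1.continuousOn.mul (h.continuousOn_curvature.mono hsub)
  obtain ⟨⟨p₁, t₁⟩, ⟨hp₁, ht₁⟩, hmin⟩ := (isCompact_Icc.prod isCompact_Icc).exists_isMinOn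
    ⟨(p, s), hp, hs0⟩ hWc
  have hmin' : ∀ q ∈ Icc a b, ∀ t ∈ Icc 0 s, W (p₁, t₁) ≤ W (q, t) :=
    fun q hq t ht => hmin (show (q, t) ∈ Icc a b ×ˢ Icc 0 s from ⟨hq, ht⟩)
  simp only at hp₁ ht₁
  have hfinal : m ≤ W (p, s) := by
    rcases eq_or_lt_of_le ht₁.1 with h0 | h0
    · refine le_trans ?_ (hmin' p hp s hs0)
      rw [← h0]
      simpa [hW] using hm0 p₁ hp₁
    · exfalso
      have ht₁T : t₁ ∈ posTime T := ⟨h0, (hmem t₁ ht₁).2⟩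
      have hspace : ∀ q ∈ Icc a b,
          familyCurvature a b c (p₁, t₁) ≤ familyCurvature a b c (q, t₁) := fun q hq =>
        le_of_mul_le_mul_left (hmin' q hq t₁ ht₁) (Real.exp_pos _)
      have h1 := h.le_partialSnd_curvature hp₁ ht₁T hspace
      have hd := hasDerivAt_partialSnd (isOpen_posTime T) h.contDiffOn_curvature
        (x := (p₁, t₁)) ⟨hp₁, ht₁T⟩
      have he : HasDerivAt (fun t => Real.exp (K * t)) (Real.exp (K * t₁) * K) t₁ := by
        simpa using ((hasDerivAt_id t₁).const_mul K).exp
      have h2 := deriv_nonpos_of_forall_le_left (s := 0) (he.mul hd).hasDerivWithinAt h0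
        (fun r hr => hmin' p₁ hp₁ r ⟨hr.1, hr.2.trans ht₁.2⟩)
      set κ := familyCurvature a b c (p₁, t₁)
      set κ' := partialSnd (familyCurvature a b c) (p₁, t₁)
      have hκ : 0 < κ := hpos t₁ ht₁ p₁ hp₁
      have h3 : K * κ + κ' ≤ 0 := by
        refine le_of_mul_le_mul_left ?_ (Real.exp_pos (K * t₁))
        have h4 : Real.exp (K * t₁) * K * κ + Real.exp (K * t₁) * κ' ≤ 0 := h2
        linarith
      have h4 := h.meanCurvature_le (hmem t₁ ht₁) (hM t₁ ht₁)
      have h5 : κ ≤ M := hM t₁ ht₁ p₁ hp₁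
      have h6 : -(M ^ 2 * κ) ≤ normalSpeed a b c (p₁, t₁) * κ ^ 2 := by
        have h7 : -M ≤ normalSpeed a b c (p₁, t₁) := by
          simp only [normalSpeed]
          linarith
        have h8 := mul_le_mul_of_nonneg_right h7 (sq_nonneg κ)
        have h9 : M * κ ^ 2 ≤ M ^ 2 * κ := by nlinarith [mul_pos (hκ.trans_le h5) hκ]
        linarith
      rw [hK] at h3
      linarith
  have h1 : W (p, s) * Real.exp (-(K * s)) = familyCurvature a b c (p, s) := by
    simp only [hW]
    rw [mul_right_comm, ← Real.exp_add, add_neg_cancel, Real.exp_zero, one_mul]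
  rw [← h1]
  exact mul_le_mul_of_nonneg_right hfinal (Real.exp_pos _).le

/-- Positivity of the curvature is preserved. -/
theorem curvature_pos (h0 : ∀ p ∈ Icc a b, 0 < PlaneCurve.curvature a b c₀ p) {t : ℝ}
    (ht : t ∈ timeInterval T) {p : ℝ} (hp : p ∈ Icc a b) : 0 < familyCurvature a b c (p, t) := by
  by_contra! hneg
  have hpos0 : ∀ q ∈ Icc a b, 0 < familyCurvature a b c (q, 0) := by
    intro q hq
    have e1 : EqOn (velocity a b (c · 0)) (velocity a b c₀) (Icc a b) := fun r hr =>
      derivWithin_congr h.initial_eq (h.initial_eq r hr)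
    have e2 : acceleration a b (c · 0) q = acceleration a b c₀ q :=
      derivWithin_congr e1 (e1 hq)
    have : familyCurvature a b c (q, 0) = PlaneCurve.curvature a b c₀ q := by
      simp only [familyCurvature, PlaneCurve.curvature, normal, tangent, e1 hq, e2]
    rw [this]
    exact h0 q hq
  have hsub : Icc a b ×ˢ Icc 0 t ⊆ Icc a b ×ˢ timeInterval T :=
    prod_mono_right fun s hs => mem_timeInterval_of_le ht hs.1 hs.2
  have hc := h.continuousOn_curvature.mono hsub
  have hcomp : IsCompact (Icc a b ×ˢ Icc 0 t) := isCompact_Icc.prod isCompact_Icc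
  obtain ⟨M, hM⟩ := hcomp.exists_bound_of_continuousOn hc
  obtain ⟨p₀, hp₀, hp₀min⟩ := (isCompact_Icc (a := a) (b := b)).exists_isMinOn
    ⟨a, left_mem_Icc.2 h.lt.le⟩
    (by simpa only [uIcc_of_le h.lt.le] using
      h.continuousOn_slice h.continuousOn_curvature h.zero_mem)
  set m := familyCurvature a b c (p₀, 0)
  have hm : 0 < m := hpos0 p₀ hp₀
  -- the first time at which the curvature is not positive
  have hZc : IsCompact ((Icc a b ×ˢ Icc 0 t) ∩ familyCurvature a b c ⁻¹' Iic 0) :=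
    hcomp.of_isClosed_subset (hc.preimage_isClosed_of_isClosed hcomp.isClosed isClosed_Iic)
      inter_subset_left
  obtain ⟨⟨p₂, t₂⟩, ⟨⟨hp₂, ht₂⟩, hκ₂⟩, hfirst⟩ := hZc.exists_isMinOn
    ⟨(p, t), ⟨hp, right_mem_Icc.2 ht.1⟩, hneg⟩ (f := Prod.snd) continuous_snd.continuousOn
  simp only [mem_preimage, mem_Iic] at hp₂ ht₂ hκ₂
  have ht₂0 : 0 < t₂ := by
    refine lt_of_le_of_ne ht₂.1 fun h00 => ?_
    rw [← h00] at hκ₂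
    linarith [hpos0 p₂ hp₂]
  -- Before t₂ the curvature is positive everywhere, so the quantitative bound applies with a
  -- constant independent of s and survives the limit s → t₂.
  have hbound : ∀ s ∈ Ico 0 t₂,
      m * Real.exp (-((M ^ 2 + 1) * t)) ≤ familyCurvature a b c (p₂, s) := by
    intro s hs
    have hst : s ≤ t := hs.2.le.trans ht₂.2
    have h1 := h.le_curvature_of_pos (s := s) (M := M) (m := m)
      (mem_timeInterval_of_le ht hs.1 hst) (fun q hq => hp₀min hq)
      (fun r hr q hq => (le_abs_self _).trans (hM (q, r) ⟨hq, hr.1, hr.2.trans hst⟩))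
      (fun r hr q hq => by
        by_contra! hle
        have h2 : t₂ ≤ r := hfirst
          (show (q, r) ∈ (Icc a b ×ˢ Icc 0 t) ∩ familyCurvature a b c ⁻¹' Iic 0 from
            ⟨⟨hq, hr.1, hr.2.trans hst⟩, hle⟩)
        linarith [hr.2, hs.2]) hp₂
    refine le_trans (mul_le_mul_of_nonneg_left (Real.exp_le_exp.2 ?_) hm.le) h1
    have : (M ^ 2 + 1) * s ≤ (M ^ 2 + 1) * t := mul_le_mul_of_nonneg_left hst (by positivity)
    linarith
  have hlim : ContinuousWithinAt (fun s => familyCurvature a b c (p₂, s)) (Ico 0 t₂) t₂ := by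
    have h1 : ContinuousOn (fun s => familyCurvature a b c (p₂, s)) (Icc 0 t) :=
      hc.comp (by fun_prop) fun s hs => ⟨hp₂, hs⟩
    exact (h1 t₂ ht₂).mono fun s hs => ⟨hs.1, hs.2.le.trans ht₂.2⟩
  have : (nhdsWithin t₂ (Ico 0 t₂)).NeBot := by
    rw [nhdsWithin_Ico_eq_nhdsLT ht₂0]; infer_instance
  have h3 := ge_of_tendsto hlim (by filter_upwards [self_mem_nhdsWithin] with s hs using hbound s hs)
  linarith [mul_pos hm (Real.exp_pos (-((M ^ 2 + 1) * t)))]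

/-- The total curvature of short curves stays below `2π`. -/
theorem totalCurvature_lt_two_pi
    (hlen : ∀ t ∈ timeInterval T, length a b (c · t) < 1 / (2 * S.curvatureMax))
    (h0 : totalCurvature a b (c · 0) < 2 * Real.pi) {t : ℝ} (ht : t ∈ timeInterval T) :
    totalCurvature a b (c · t) < 2 * Real.pi := by
  by_contra! hge
  have hpre := ((ordConnected_timeInterval T).isPreconnected.image _
    h.continuousOn_totalCurvature).ordConnected
  -- The total curvature would take the value 2π at some time, where its cosine is 1 instead of
  -- below -1/2.
  obtain ⟨s, hs, hs2⟩ := hpre.out ⟨0, h.zero_mem, rfl⟩ ⟨t, ht, rfl⟩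
    (show 2 * Real.pi ∈ Icc _ _ from ⟨h0.le, hge⟩)
  have h1 := SupportCurve.cos_totalCurvature_lt h.lt (h.contDiffOn_slice hs) (h.regular s hs)
    (h.angle_left s hs) (h.angle_right s hs) (hlen s hs)
  simp only at hs2
  rw [hs2, Real.cos_two_pi] at h1
  linarith

end IsSolution

/-! ### Conclusion. -/

theorem mainTheorem8 (S : SupportCurve) :
    0 < 1 / (2 * S.curvatureMax) ∧
    ∀ (a b : ℝ) (T : EReal) (c₀ : ℝ → ℂ) (c : ℝ → ℝ → ℂ),
      IsSolution S a b T c₀ c →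
      (∀ p ∈ Set.Icc a b, 0 < PlaneCurve.curvature a b c₀ p) →
      Set.InjOn c₀ (Set.Icc a b) →
      (∀ p ∈ Set.Ioo a b, c₀ p ∈ S.outerDomain) →
      PlaneCurve.length a b c₀ < S.width →
      PlaneCurve.length a b c₀ < 1 / (2 * S.curvatureMax) →
      (∀ t ∈ timeInterval T, PlaneCurve.Embedded a b (fun p => c p t)) ∧
      (∀ t ∈ timeInterval T, PlaneCurve.BoundsConvexDomain a b (fun p => c p t)) := by
  refine ⟨one_div_pos.2 (mul_pos two_pos S.curvatureMax_pos), ?_⟩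
  intro a b T c₀ c h hκ hinj houter _ hlen
  have hvel : ∀ p ∈ Icc a b, velocity a b (c · 0) p = velocity a b c₀ p := fun p hp =>
    derivWithin_congr h.initial_eq (h.initial_eq p hp)
  have hlen0 : length a b (c · 0) = length a b c₀ := by
    refine intervalIntegral.integral_congr fun p hp => ?_
    rw [uIcc_of_le h.lt.le] at hp
    simp only [hvel p hp]
  have hlen' : ∀ t ∈ timeInterval T, length a b (c · t) < 1 / (2 * S.curvatureMax) :=
    fun t ht => lt_of_le_of_lt (h.antitoneOn_length h.zero_mem ht ht.1)
      (show length a b (c · 0) < _ by rw [hlen0]; exact hlen)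
  have hemb : Embedded a b (c · 0) :=
    ⟨h.regular 0 h.zero_mem, hinj.congr fun p hp => (h.initial_eq p hp).symm⟩
  have h0 := SupportCurve.totalCurvature_lt_two_pi h.lt (h.contDiffOn_slice h.zero_mem) hemb
    (h.angle_left 0 h.zero_mem) (h.angle_right 0 h.zero_mem)
    (fun p hp => by rw [h.initial_eq p ⟨hp.1.le, hp.2.le⟩]; exact houter p hp)
    (hlen' 0 h.zero_mem)
  -- From here on every time is treated separately; injectivity and outer position of the curve were
  -- needed only at t = 0, to bound the total curvature.
  have hconv : ∀ t ∈ timeInterval T, ∃ ρ θ, LeftTurning.ConvexArc a b (c · t) ρ θ :=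
    fun t ht => SupportCurve.exists_convexArc h.lt (h.contDiffOn_slice ht) (h.regular t ht)
      (fun p hp => h.curvature_pos hκ ht hp) (h.angle_left t ht) (h.angle_right t ht)
      (hlen' t ht) (h.totalCurvature_lt_two_pi hlen' h0 ht)
  refine ⟨fun t ht => ?_, fun t ht => ?_⟩
  · obtain ⟨ρ, θ, hC⟩ := hconv t ht
    exact ⟨h.regular t ht, hC.injOn⟩
  · obtain ⟨ρ, θ, hC⟩ := hconv t ht
    exact hC.boundsConvexDomain

end
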